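/- Let $\mathfrak G$ be a compact connected Lie group with Lie algebra $G$ and an $\mathrm{Ad}_{\mathfrak G}$-invariant scalar product $\langle\cdot,\cdot\rangle$ on $G$, by which $G\cong G^*$ and $T\mathfrak G\cong T^*\mathfrak G$ (a covector $p$ at $g$ corresponds to $g\cdot x$, where $x\in G$ is given by $p(g\cdot\omega)=\langle x,\omega\rangle$ for all $\omega\in G$). Let $I:G\to G$ be a symmetric positive definite operator, $A=I^{-1}$, and let $(g\cdot\omega_1,g\cdot\omega_2)_g=\langle I\omega_1,\omega_2\rangle$ be the left-invariant metric on $\mathfrak G$ induced by $I$. Let $D\subset G$ be a linear subspace, $L=D^\perp$ its orthogonal complement with respect to $\langle\cdot,\cdot\rangle$, and $\mathcal D_g=g\cdot D$ the corresponding left-invariant distribution. Suppose that - $A$ preserves the decomposition $G=L+D$, i.e. $A(L)\subset L$ and $A(D)\subset D$; - $L$ is the Lie algebra of a connected Lie subgroup $\mathfrak L\subset\mathfrak G$; - $H_D(\xi)=\frac12\langle\xi,A\xi\rangle$, $\xi\in D$, is invariant under the adjoint action of $\mathfrak L$ on $D$; - $D$ generates the Lie algebra $G$ by commutators. Let $H(x)=\frac12\langle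 x,Ax\rangle$ and $H^*(x)=\frac12\langle x,A\,x_D\rangle$ for $x\in G$, where $x_D$ is the orthogonal projection of $x$ to $D$, and let $h,h^*:T^*\mathfrak G\to\mathbb R$ be the functions obtained from $H,H^*$ by left translations. Then: 1. The constraint submanifold $\mathcal M=\{(g,p): p=(v,\cdot)_g \text{ for some } v\in\mathcal D_g\}$ of $T^*\mathfrak G$ is identified with $\mathcal D\subset T\mathfrak G$. The function $h$ is the Hamiltonian $\frac12\,p(v_p)$, $(v_p,\cdot)_g=p$, of the geodesic flow of the metric, and $h^*$ is the normal Hamiltonian $\sup_{v\in\mathcal D_g}\big(p(v)-\frac12(v,v)_g\big)$ of the sub-Riemannian metric that the metric induces on $\mathcal D$. 2. On $\mathcal M=\mathcal D$ the following three problems have the same flow: the nonholonomic geodesic flow, i.e. $\dot q=\partial h/\partial p$, $\dot p=-\partial h/\partial q+F$ in canonical coordinates, where the reaction force $F$ annihilates $\mathcal D_q$ and is such that the trajectory stays in $\mathcal M$; the geodesic flow, i.e. the Hamiltonian flow of $h$; and the normal sub-Riemannian geodesic flow, i.e. the Hamiltonian flow of $h^*$. That is, there is one flow $\Phi^t:\mathcal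 M\to\mathcal M$, $t\in\mathbb R$, whose orbits solve all three systems, and every solution of any of the three systems, on any open time interval, that meets $\mathcal M$ moves along $\Phi^t$. -/

import Mathlib

open scoped Manifold ContDiff

noncomputable section

namespace Nonholonomic

/-! ### Mechanics on the cotangent bundle of a manifold `Q` modelled on `E` -/

section Mechanics

variable {E : Type*} [NormedAddCommGroup E] [NormedSpace ℝ E]
  {Q : Type*} [TopologicalSpace Q] [ChartedSpace E Q]

variable (E Q) in
/-- The phase space `T^*Q`: a point is a pair `⟨q, p⟩` with `p` a covector at `q`. -/
abbrev PhaseSpace : Type _ :=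
  Bundle.TotalSpace (E →L[ℝ] ℝ) (fun q : Q => TangentSpace 𝓘(ℝ, E) q →L[ℝ] ℝ)

/-- The components, in the preferred chart `φ` at `q₀`, of a covector `x.2` at the point `x.1`,
i.e. the covector `x.2 ∘ d(φ⁻¹)` on `E`. -/
def covectorCoords (q₀ : Q) (x : PhaseSpace E Q) : E →L[ℝ] ℝ :=
  x.2.comp (mfderiv 𝓘(ℝ, E) 𝓘(ℝ, E) (extChartAt 𝓘(ℝ, E) q₀).symm
    (extChartAt 𝓘(ℝ, E) q₀ x.1))

/-- The canonical coordinates `(q, p)` on `T^*Q` induced by the preferred chart at `q₀`. -/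
def canonicalCoords (q₀ : Q) (x : PhaseSpace E Q) : E × (E →L[ℝ] ℝ) :=
  (extChartAt 𝓘(ℝ, E) q₀ x.1, covectorCoords q₀ x)

/-- The point of `T^*Q` with given canonical coordinates (inverse of `canonicalCoords q₀`). -/
def ofCanonicalCoords (q₀ : Q) (z : E × (E →L[ℝ] ℝ)) : PhaseSpace E Q :=
  ⟨(extChartAt 𝓘(ℝ, E) q₀).symm z.1,
    ContinuousLinearMap.comp z.2 (mfderiv 𝓘(ℝ, E) 𝓘(ℝ, E) (extChartAt 𝓘(ℝ, E) q₀)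
      ((extChartAt 𝓘(ℝ, E) q₀).symm z.1))⟩

/-- At time `t` the curve `γ` in `T^*Q` has velocity `X_h(γ(t)) + vert F`, where `F` is a covector
(a force) at the base point of `γ(t)`. In canonical coordinates `(q, p)` around that point:
`q' = ∂h/∂p` and `p' = - ∂h/∂q + F`. -/
def ObeysHamiltonEqAt (h : PhaseSpace E Q → ℝ) (γ : ℝ → PhaseSpace E Q) (t : ℝ)
    (F : TangentSpace 𝓘(ℝ, E) (γ t).1 →L[ℝ] ℝ) : Prop :=
  ContinuousAt (fun s => (γ s).1) t ∧
  DifferentiableAt ℝ (fun z => h (ofCanonicalCoords (γ t).1 z))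
    (canonicalCoords (γ t).1 (γ t)) ∧
  ∃ (q' : E) (p' : E →L[ℝ] ℝ),
    HasDerivAt (fun s => canonicalCoords (γ t).1 (γ s)) (q', p') t ∧
    (∀ β : E →L[ℝ] ℝ, β q' = fderiv ℝ (fun z => h (ofCanonicalCoords (γ t).1 z))
      (canonicalCoords (γ t).1 (γ t)) (0, β)) ∧
    (∀ e : E, p' e = - fderiv ℝ (fun z => h (ofCanonicalCoords (γ t).1 z))
      (canonicalCoords (γ t).1 (γ t)) (e, 0) + covectorCoords (γ t).1 ⟨(γ t).1, F⟩ e)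

/-- `γ` solves `x' = X_h(x)` on the (open) time set `J`. -/
def IsHamiltonianTrajectory (h : PhaseSpace E Q → ℝ) (J : Set ℝ) (γ : ℝ → PhaseSpace E Q) : Prop :=
  ∀ t ∈ J, ObeysHamiltonEqAt h γ t 0

/-- The constraint submanifold `{(q, p) | p ∈ m_q(Δ_q)}` of `T^*Q` of the distribution `Δ`, with
respect to the metric `m`, seen as a family of maps `m_q : T_qQ → T_q^*Q`. -/
def constraintSubmanifold
    (m : ∀ q : Q, TangentSpace 𝓘(ℝ, E) q →L[ℝ] TangentSpace 𝓘(ℝ, E) q →L[ℝ] ℝ)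
    (Δ : ∀ q : Q, Submodule ℝ (TangentSpace 𝓘(ℝ, E) q)) : Set (PhaseSpace E Q) :=
  {x | ∃ v ∈ Δ x.1, x.2 = m x.1 v}

/-- The Hamiltonian `h(q, p) = ½ p(m_q⁻¹ p)` of the geodesic flow of the metric `m`. -/
def geodesicHamiltonian
    (m : ∀ q : Q, TangentSpace 𝓘(ℝ, E) q →L[ℝ] TangentSpace 𝓘(ℝ, E) q →L[ℝ] ℝ)
    (x : PhaseSpace E Q) : ℝ :=
  (1 / 2) * x.2 ((m x.1).inverse x.2)

/-- The normal Hamiltonian of the sub-Riemannian structure obtained by restricting the metric `m`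
to the distribution `Δ`: the Legendre transform `(q, p) ↦ sup_{v ∈ Δ_q} (p(v) - ½ m_q(v, v))` of the
sub-Riemannian energy. Its Hamiltonian flow is the normal sub-Riemannian geodesic flow. -/
def subRiemannianHamiltonian
    (m : ∀ q : Q, TangentSpace 𝓘(ℝ, E) q →L[ℝ] TangentSpace 𝓘(ℝ, E) q →L[ℝ] ℝ)
    (Δ : ∀ q : Q, Submodule ℝ (TangentSpace 𝓘(ℝ, E) q)) (x : PhaseSpace E Q) : ℝ :=
  ⨆ v : Δ x.1, (x.2 (v : TangentSpace 𝓘(ℝ, E) x.1) - (1 / 2) * m x.1 v v)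

/-- `γ` is a phase trajectory, on the (open) time set `J`, of the nonholonomic geodesic flow of the
metric `m` with constraint distribution `Δ`: it stays in the constraint submanifold and solves the
d'Alembert--Lagrange equations `x' = X_h(x) + vert F` for some reaction force `F` annihilating `Δ`
(a combination `∑ λᵢ αᵢ` of the one-forms that define `Δ`). -/
def IsNonholonomicTrajectory
    (m : ∀ q : Q, TangentSpace 𝓘(ℝ, E) q →L[ℝ] TangentSpace 𝓘(ℝ, E) q →L[ℝ] ℝ)
    (Δ : ∀ q : Q, Submodule ℝ (TangentSpace 𝓘(ℝ, E) q)) (J : Set ℝ) (γ : ℝ → PhaseSpace E Q) :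
    Prop :=
  ∀ t ∈ J, γ t ∈ constraintSubmanifold m Δ ∧
    ∃ F : TangentSpace 𝓘(ℝ, E) (γ t).1 →L[ℝ] ℝ,
      (∀ v ∈ Δ (γ t).1, F v = 0) ∧ ObeysHamiltonEqAt (geodesicHamiltonian m) γ t F

end Mechanics

/-- `Φ` is the (complete) flow on the subset `S` of `X` of the equation of motion whose solutions on
open time intervals `J` are given by `Sol J`: it is a one-parameter group of maps of `S`, its orbits
are solutions, and every solution that meets `S` moves along it. -/
structure IsFlowOn {X : Type*} (Sol : Set ℝ → (ℝ → X) → Prop) (S : Set X) (Φ : ℝ → S → S) :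
    Prop where
  zero : ∀ x, Φ 0 x = x
  add : ∀ s t x, Φ (s + t) x = Φ s (Φ t x)
  sol : ∀ x, Sol Set.univ (fun t => (Φ t x : X))
  unique : ∀ (J : Set ℝ), IsOpen J → J.OrdConnected → ∀ γ : ℝ → X, Sol J γ →
    ∀ s ∈ J, ∀ hs : γ s ∈ S, ∀ t ∈ J, γ t = Φ (t - s) ⟨γ s, hs⟩

/-! ### Lie groups -/

section LieGroups

variable {E : Type*} [NormedAddCommGroup E] [NormedSpace ℝ E]
  {G : Type*} [TopologicalSpace G] [ChartedSpace E G] [Group G]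

instance instLieGroupMinSmoothness [h : LieGroup 𝓘(ℝ, E) ∞ G] :
    LieGroup 𝓘(ℝ, E) (minSmoothness ℝ 3) G :=
  LieGroup.of_le (n := ∞) (by
    rw [minSmoothness_of_isRCLikeNormedField]
    exact ENat.LEInfty.out)

variable (E) in
/-- The differential at the identity of the left translation by `g`, `ω ↦ g · ω`. -/
def leftTranslation (g : G) : GroupLieAlgebra 𝓘(ℝ, E) G →L[ℝ] TangentSpace 𝓘(ℝ, E) g :=
  mfderiv 𝓘(ℝ, E) 𝓘(ℝ, E) (fun x : G => g * x) 1

variable (E) in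
/-- The adjoint action `Ad_g`, the differential at the identity of `x ↦ g x g⁻¹`. -/
def adjointAction (g : G) : GroupLieAlgebra 𝓘(ℝ, E) G →L[ℝ] GroupLieAlgebra 𝓘(ℝ, E) G :=
  mfderiv 𝓘(ℝ, E) 𝓘(ℝ, E) (fun x : G => g * x * g⁻¹) 1

variable (E G) in
/-- A scalar product on the Lie algebra that is invariant under the adjoint action of `G`. -/
structure AdInvariantScalarProduct where
  form : GroupLieAlgebra 𝓘(ℝ, E) G →L[ℝ] GroupLieAlgebra 𝓘(ℝ, E) G →L[ℝ] ℝ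
  symm : ∀ v w, form v w = form w v
  pos : ∀ v, v ≠ 0 → 0 < form v v
  ad_invariant : ∀ (g : G) v w, form (adjointAction E g v) (adjointAction E g w) = form v w

namespace AdInvariantScalarProduct

variable (B : AdInvariantScalarProduct E G)

/-- The orthogonal complement of a subspace of the Lie algebra. -/
def orthogonal (D : Submodule ℝ (GroupLieAlgebra 𝓘(ℝ, E) G)) :
    Submodule ℝ (GroupLieAlgebra 𝓘(ℝ, E) G) where
  carrier := {η | ∀ ξ ∈ D, B.form ξ η = 0}
  add_mem' := by
    intro a b ha hb ξ hξ
    rw [map_add, ha ξ hξ, hb ξ hξ, add_zero]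
  zero_mem' := by
    intro ξ _
    exact map_zero _
  smul_mem' := by
    intro c a ha ξ hξ
    rw [map_smul, ha ξ hξ, smul_zero]

theorem isCompl_orthogonal [FiniteDimensional ℝ E]
    (D : Submodule ℝ (GroupLieAlgebra 𝓘(ℝ, E) G)) : IsCompl D (B.orthogonal D) := by
  have : FiniteDimensional ℝ (GroupLieAlgebra 𝓘(ℝ, E) G) :=
    inferInstanceAs (FiniteDimensional ℝ E)
  let b : LinearMap.BilinForm ℝ (GroupLieAlgebra 𝓘(ℝ, E) G) :=
    LinearMap.mk₂ ℝ (fun v w => B.form v w) (by intros; simp) (by intros; simp)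
      (by intros; simp) (by intros; simp)
  have hb : ∀ v w, b v w = B.form v w := fun v w => rfl
  have hrefl : b.IsRefl := by
    intro v w h
    rw [hb] at h ⊢
    rw [B.symm, h]
  have ho : b.orthogonal D = B.orthogonal D := by
    ext η
    exact Iff.rfl
  rw [← ho, LinearMap.BilinForm.isCompl_orthogonal_iff_disjoint hrefl, Submodule.disjoint_def]
  intro x hx hx'
  by_contra hne
  have h1 := B.pos x hne
  have h2 : B.form x x = 0 := hx' x hx
  linarith

/-- The orthogonal projection `x ↦ x_D` onto the subspace `D` of the Lie algebra. -/
def proj [FiniteDimensional ℝ E] (D : Submodule ℝ (GroupLieAlgebra 𝓘(ℝ, E) G)) :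
    GroupLieAlgebra 𝓘(ℝ, E) G →ₗ[ℝ] GroupLieAlgebra 𝓘(ℝ, E) G :=
  D.projection (B.orthogonal D) (B.isCompl_orthogonal D)

/-- The left-invariant metric `(g·ω₁, g·ω₂)_g = ⟨I ω₁, ω₂⟩` induced by the operator `I`. -/
def leftInvariantMetric (I : GroupLieAlgebra 𝓘(ℝ, E) G →L[ℝ] GroupLieAlgebra 𝓘(ℝ, E) G) (g : G) :
    TangentSpace 𝓘(ℝ, E) g →L[ℝ] TangentSpace 𝓘(ℝ, E) g →L[ℝ] ℝ :=
  (ContinuousLinearMap.precomp ℝ (leftTranslation E g).inverse).comp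
    (B.form.comp (I.comp (leftTranslation E g).inverse))

/-- The map `Λ : T^*G → Lie(G)`, which sends the covector `p` at `g` to the vector `x` with
`p(g·ω) = ⟨x, ω⟩` for all `ω`: the identification of `T^*G` with `TG` by the bi-invariant metric,
followed by the left translation to the identity. -/
def toLieAlgebra (x : PhaseSpace E G) : GroupLieAlgebra 𝓘(ℝ, E) G :=
  B.form.inverse (x.2.comp (leftTranslation E x.1))

/-- The function on `T^*G` obtained from a function `F` on the Lie algebra by left translations. -/
def leftExtend (F : GroupLieAlgebra 𝓘(ℝ, E) G → ℝ) (x : PhaseSpace E G) : ℝ :=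
  F (B.toLieAlgebra x)

/-- The reduced Hamiltonian `H(x) = ½ ⟨x, A x⟩`. -/
def reducedHamiltonian (A : GroupLieAlgebra 𝓘(ℝ, E) G →L[ℝ] GroupLieAlgebra 𝓘(ℝ, E) G)
    (x : GroupLieAlgebra 𝓘(ℝ, E) G) : ℝ :=
  (1 / 2) * B.form x (A x)

/-- The function `H^*(x) = ½ ⟨x, A^* x⟩`, where `A^* x = A x_D`. -/
def reducedHamiltonianStar [FiniteDimensional ℝ E]
    (A : GroupLieAlgebra 𝓘(ℝ, E) G →L[ℝ] GroupLieAlgebra 𝓘(ℝ, E) G)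
    (D : Submodule ℝ (GroupLieAlgebra 𝓘(ℝ, E) G)) (x : GroupLieAlgebra 𝓘(ℝ, E) G) : ℝ :=
  (1 / 2) * B.form x (A (B.proj D x))

end AdInvariantScalarProduct

/-- The left-invariant distribution `𝒟_g = g · D`. -/
def leftInvariantDistribution (D : Submodule ℝ (GroupLieAlgebra 𝓘(ℝ, E) G)) (g : G) :
    Submodule ℝ (TangentSpace 𝓘(ℝ, E) g) :=
  D.map (leftTranslation E g : GroupLieAlgebra 𝓘(ℝ, E) G →ₗ[ℝ] TangentSpace 𝓘(ℝ, E) g)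

/-- `ι : K → G` exhibits the Lie group `K` as an (immersed) Lie subgroup of `G`. -/
structure IsLieSubgroup {E' : Type*} [NormedAddCommGroup E'] [NormedSpace ℝ E']
    {K : Type*} [TopologicalSpace K] [ChartedSpace E' K] [Group K] (ι : K →* G) : Prop where
  contMDiff : ContMDiff 𝓘(ℝ, E') 𝓘(ℝ, E) ∞ ι
  injective : Function.Injective ι
  immersion : ∀ k : K, Function.Injective (mfderiv 𝓘(ℝ, E') 𝓘(ℝ, E) ι k)

/-- The Lie algebra of the Lie subgroup `ι : K → G`, as a subspace of the Lie algebra of `G`. -/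
def lieAlgebraOfSubgroup {E' : Type*} [NormedAddCommGroup E'] [NormedSpace ℝ E']
    {K : Type*} [TopologicalSpace K] [ChartedSpace E' K] [Group K] (ι : K →* G) :
    Submodule ℝ (GroupLieAlgebra 𝓘(ℝ, E) G) :=
  LinearMap.range (M₂ := E) (mfderiv 𝓘(ℝ, E') 𝓘(ℝ, E) ι 1).toLinearMap

end LieGroups

end Nonholonomic

end

open Nonholonomic

noncomputable section

open scoped Topology

/-! Write a covector at g as (g, x) with p(g·ω) = ⟨x, ω⟩. For the left-invariant Hamiltonian ½⟨x, S
x⟩, S symmetric, and a force F, the canonical equations become g' = g·S x, x' = [x, S x] + f, where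
f represents F in the Lie algebra (`obeysHamiltonEqAt_iff`). Invariance of the scalar product enters
as ⟨x, [u, w]⟩ = ⟨[x, u], w⟩, which turns the coadjoint term into a bracket. In this picture the
constraint is x ∈ D because A preserves D, a force annihilating the distribution is an f ∈ L, h is
the case S = A, and h^* is the case S = A ∘ pr_D, which is symmetric because A commutes with pr_D.

The key fact is that [ξ, A ξ] ∈ D for ξ ∈ D (`bracket_mem_of_invariant`). Differentiating the
invariance of H_D at the identity of the subgroup along η ∈ L gives ⟨[η, ξ], A ξ⟩ = 0, that is ⟨η,
[ξ, A ξ]⟩ = 0, so [ξ, A ξ] is orthogonal to L. Hence the Euler field x ↦ [x, A x] is tangent to D.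
On a nonholonomic trajectory f = x' - [x, A x] then lies in D ∩ L = 0, so the reaction vanishes. On
D the operators A and A ∘ pr_D agree, so the same curves solve the sub-Riemannian equations.

These curves exist for all time: ⟨x, [x, A x]⟩ = 0 confines x to a sphere, and left translations
make the existence time uniform in g (`exists_leftCurve_of_form_conserved`). By uniqueness for the
ODE on G × E, any solution of one of the systems that meets the constraint is one of these curves
(`exists_common_flow`). -/

namespace Nonholonomic

/-! ### The left-invariant frame in a chart -/

section LeftFrame

variable {E : Type*} [NormedAddCommGroup E] [NormedSpace ℝ E]
  {G : Type*} [TopologicalSpace G] [ChartedSpace E G]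

/-- The derivative of the preferred chart at `q₀`, as an endomorphism of the model space. -/
def chartDeriv (q₀ q : G) : E →L[ℝ] E :=
  mfderiv 𝓘(ℝ, E) 𝓘(ℝ, E) (extChartAt 𝓘(ℝ, E) q₀) q

/-- The derivative of the inverse of the preferred chart at `q₀`, as an endomorphism of the model
space. -/
def chartSymmDeriv (q₀ : G) (z : E) : E →L[ℝ] E :=
  mfderiv 𝓘(ℝ, E) 𝓘(ℝ, E) (extChartAt 𝓘(ℝ, E) q₀).symm z

section Charts

variable [IsManifold 𝓘(ℝ, E) 1 G]

theorem chartDeriv_self (q : G) : chartDeriv (E := E) q q = ContinuousLinearMap.id ℝ E :=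
  mfderiv_extChartAt_self

theorem chartDeriv_comp_chartSymmDeriv {q₀ q : G} (hq : q ∈ (extChartAt 𝓘(ℝ, E) q₀).source) :
    (chartDeriv q₀ q).comp (chartSymmDeriv q₀ (extChartAt 𝓘(ℝ, E) q₀ q)) =
      ContinuousLinearMap.id ℝ E := by
  have h := mfderiv_extChartAt_comp_mfderivWithin_extChartAt_symm' (I := 𝓘(ℝ, E)) hq
  rw [ModelWithCorners.range_eq_univ, mfderivWithin_univ] at h
  exact h

theorem chartSymmDeriv_comp_chartDeriv {q₀ q : G} (hq : q ∈ (extChartAt 𝓘(ℝ, E) q₀).source) :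
    (chartSymmDeriv q₀ (extChartAt 𝓘(ℝ, E) q₀ q)).comp (chartDeriv q₀ q) =
      ContinuousLinearMap.id ℝ E := by
  have h := mfderivWithin_extChartAt_symm_comp_mfderiv_extChartAt' (I := 𝓘(ℝ, E)) hq
  rw [ModelWithCorners.range_eq_univ, mfderivWithin_univ] at h
  exact h

theorem chartSymmDeriv_self (q : G) :
    chartSymmDeriv q (extChartAt 𝓘(ℝ, E) q q) = ContinuousLinearMap.id ℝ E := by
  have h := chartSymmDeriv_comp_chartDeriv (E := E) (mem_extChartAt_source (I := 𝓘(ℝ, E)) q)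
  rwa [chartDeriv_self, ContinuousLinearMap.comp_id] at h

theorem hasMFDerivAt_chart {q₀ q : G} (hq : q ∈ (extChartAt 𝓘(ℝ, E) q₀).source) :
    HasMFDerivAt 𝓘(ℝ, E) 𝓘(ℝ, E) (extChartAt 𝓘(ℝ, E) q₀) q (chartDeriv (E := E) q₀ q) :=
  (mdifferentiableAt_extChartAt (by rwa [extChartAt_source] at hq)).hasMFDerivAt

theorem hasMFDerivAt_chart_symm {q₀ : G} {z : E} (hz : z ∈ (extChartAt 𝓘(ℝ, E) q₀).target) :
    HasMFDerivAt 𝓘(ℝ, E) 𝓘(ℝ, E) (extChartAt 𝓘(ℝ, E) q₀).symm z (chartSymmDeriv (E := E) q₀ z) := by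
  have h := mdifferentiableWithinAt_extChartAt_symm (I := 𝓘(ℝ, E)) hz
  rw [ModelWithCorners.range_eq_univ, mdifferentiableWithinAt_univ] at h
  exact h.hasMFDerivAt

end Charts

variable [Group G]

/-- The differential at the identity of the left translation by `g`, as an endomorphism of the
model space. -/
def leftDeriv (g : G) : E →L[ℝ] E := leftTranslation E g

/-- The left-invariant frame in the preferred chart at `q₀`. -/
def leftFrame (q₀ : G) (z : E) : E →L[ℝ] E :=
  (chartDeriv q₀ ((extChartAt 𝓘(ℝ, E) q₀).symm z)).comp
    (leftDeriv ((extChartAt 𝓘(ℝ, E) q₀).symm z))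

/-- The group multiplication, in the preferred chart at `1` for the second factor and the one at
`q₀` for the first factor and the product. -/
def mulChart (q₀ : G) (z : E × E) : E :=
  extChartAt 𝓘(ℝ, E) q₀ ((extChartAt 𝓘(ℝ, E) q₀).symm z.1 * (extChartAt 𝓘(ℝ, E) (1 : G)).symm z.2)

variable [LieGroup 𝓘(ℝ, E) ∞ G]

theorem hasMFDerivAt_mul_left_one (g : G) :
    HasMFDerivAt 𝓘(ℝ, E) 𝓘(ℝ, E) (fun x : G => g * x) 1 (leftDeriv (E := E) g) :=
  ((contMDiff_mul_left (I := 𝓘(ℝ, E)) (n := ∞) (a := g)).mdifferentiable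
    (by simp)).mdifferentiableAt.hasMFDerivAt

theorem contDiffAt_mulChart (q₀ : G) :
    ContDiffAt ℝ ∞ (mulChart (E := E) q₀)
      (extChartAt 𝓘(ℝ, E) q₀ q₀, extChartAt 𝓘(ℝ, E) (1 : G) 1) := by
  rw [← contMDiffAt_iff_contDiffAt]
  have h1 : ContMDiffAt 𝓘(ℝ, E × E) 𝓘(ℝ, E) ∞
      (fun z : E × E => (extChartAt 𝓘(ℝ, E) q₀).symm z.1)
      (extChartAt 𝓘(ℝ, E) q₀ q₀, extChartAt 𝓘(ℝ, E) (1 : G) 1) := by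
    refine ContMDiffAt.comp (I' := 𝓘(ℝ, E)) _ (g := (extChartAt 𝓘(ℝ, E) q₀).symm)
      (f := Prod.fst) ?_ contDiff_fst.contMDiff.contMDiffAt
    exact (contMDiffOn_extChartAt_symm q₀).contMDiffAt (x := extChartAt 𝓘(ℝ, E) q₀ q₀)
      (extChartAt_target_mem_nhds q₀)
  have h2 : ContMDiffAt 𝓘(ℝ, E × E) 𝓘(ℝ, E) ∞
      (fun z : E × E => (extChartAt 𝓘(ℝ, E) (1 : G)).symm z.2)
      (extChartAt 𝓘(ℝ, E) q₀ q₀, extChartAt 𝓘(ℝ, E) (1 : G) 1) := by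
    refine ContMDiffAt.comp (I' := 𝓘(ℝ, E)) _ (g := (extChartAt 𝓘(ℝ, E) (1 : G)).symm)
      (f := Prod.snd) ?_ contDiff_snd.contMDiff.contMDiffAt
    exact (contMDiffOn_extChartAt_symm (1 : G)).contMDiffAt (x := extChartAt 𝓘(ℝ, E) (1 : G) 1)
      (extChartAt_target_mem_nhds _)
  refine ContMDiffAt.comp (I' := 𝓘(ℝ, E)) _ (g := extChartAt 𝓘(ℝ, E) q₀) ?_ (h1.mul h2)
  apply contMDiffAt_extChartAt'
  simp

theorem hasFDerivAt_mulChart_snd {q₀ : G} {z : E} (hz : z ∈ (extChartAt 𝓘(ℝ, E) q₀).target) :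
    HasFDerivAt (fun y => mulChart q₀ (z, y)) (leftFrame q₀ z) (extChartAt 𝓘(ℝ, E) (1 : G) 1) := by
  refine hasMFDerivAt_iff_hasFDerivAt.1 ?_
  have h1 := hasMFDerivAt_chart_symm (mem_extChartAt_target (I := 𝓘(ℝ, E)) (1 : G))
  rw [chartSymmDeriv_self] at h1
  have h2 : HasMFDerivAt 𝓘(ℝ, E) 𝓘(ℝ, E)
      (fun x : G => (extChartAt 𝓘(ℝ, E) q₀).symm z * x)
      ((extChartAt 𝓘(ℝ, E) (1 : G)).symm (extChartAt 𝓘(ℝ, E) (1 : G) 1))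
      (leftDeriv (E := E) ((extChartAt 𝓘(ℝ, E) q₀).symm z)) := by
    rw [extChartAt_to_inv]
    exact hasMFDerivAt_mul_left_one _
  have h3 : HasMFDerivAt 𝓘(ℝ, E) 𝓘(ℝ, E) (extChartAt 𝓘(ℝ, E) q₀)
      ((extChartAt 𝓘(ℝ, E) q₀).symm z *
        (extChartAt 𝓘(ℝ, E) (1 : G)).symm (extChartAt 𝓘(ℝ, E) (1 : G) 1))
      (chartDeriv (E := E) q₀ ((extChartAt 𝓘(ℝ, E) q₀).symm z)) := by
    rw [extChartAt_to_inv, mul_one]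
    exact hasMFDerivAt_chart ((extChartAt 𝓘(ℝ, E) q₀).map_target hz)
  have h4 := h2.comp (extChartAt 𝓘(ℝ, E) (1 : G) 1) h1
  exact HasMFDerivAt.comp (extChartAt 𝓘(ℝ, E) (1 : G) 1) (f := fun y =>
    (extChartAt 𝓘(ℝ, E) q₀).symm z * (extChartAt 𝓘(ℝ, E) (1 : G)).symm y) h3 h4

/-- Exhibits the frame as a partial derivative of a smooth map. This gives its smoothness, and later
the comparison with the right-invariant frame through second derivatives. -/
theorem leftFrame_eventuallyEq (q₀ : G) :
    (fun z => fderiv ℝ (fun y => mulChart q₀ (z, y)) (extChartAt 𝓘(ℝ, E) (1 : G) 1)) =ᶠ[𝓝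
      (extChartAt 𝓘(ℝ, E) q₀ q₀)] leftFrame (E := E) q₀ := by
  filter_upwards [extChartAt_target_mem_nhds (I := 𝓘(ℝ, E)) q₀] with z hz
  exact (hasFDerivAt_mulChart_snd hz).fderiv

theorem contDiffAt_leftFrame (q₀ : G) :
    ContDiffAt ℝ ∞ (leftFrame (E := E) q₀) (extChartAt 𝓘(ℝ, E) q₀ q₀) := by
  refine ContDiffAt.congr_of_eventuallyEq ?_ (leftFrame_eventuallyEq q₀).symm
  refine ContDiffAt.fderiv (f := fun z y => mulChart q₀ (z, y)) (n := ∞) (m := ∞)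
    (g := fun _ => extChartAt 𝓘(ℝ, E) (1 : G) 1) ?_ contDiffAt_const (by simp)
  exact contDiffAt_mulChart q₀

theorem leftFrame_self (q₀ : G) :
    leftFrame q₀ (extChartAt 𝓘(ℝ, E) q₀ q₀) = leftDeriv (E := E) q₀ := by
  rw [leftFrame, extChartAt_to_inv, chartDeriv_self, ContinuousLinearMap.id_comp]

end LeftFrame

/-! ### The Lie bracket as the antisymmetrized derivative of the frame -/

section Bracket

variable {E : Type*} [NormedAddCommGroup E] [NormedSpace ℝ E]
  {G : Type*} [TopologicalSpace G] [ChartedSpace E G] [Group G]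

variable (E G) in
/-- The Lie bracket of the Lie algebra, as a bilinear map on the model space. -/
def bracketCLM : E →L[ℝ] E →L[ℝ] E :=
  fderiv ℝ (leftFrame (E := E) (1 : G)) (extChartAt 𝓘(ℝ, E) (1 : G) 1) -
    (fderiv ℝ (leftFrame (E := E) (1 : G)) (extChartAt 𝓘(ℝ, E) (1 : G) 1)).flip

theorem bracketCLM_swap (v w : E) : bracketCLM E G v w = -bracketCLM E G w v := by
  simp [bracketCLM]

variable [LieGroup 𝓘(ℝ, E) ∞ G]

theorem differentiableAt_leftFrame (q₀ : G) :
    DifferentiableAt ℝ (leftFrame (E := E) q₀) (extChartAt 𝓘(ℝ, E) q₀ q₀) :=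
  (contDiffAt_leftFrame q₀).differentiableAt (by simp)

theorem leftDeriv_one : leftDeriv (1 : G) = ContinuousLinearMap.id ℝ E := by
  have h := hasMFDerivAt_mul_left_one (E := E) (1 : G)
  have h' : (fun x : G => 1 * x) = id := by ext x; simp
  rw [h'] at h
  exact hasMFDerivAt_unique h (hasMFDerivAt_id 1)

theorem mpullback_chart_symm_eventuallyEq (q₀ : G) (v : E) :
    (fun z => (chartSymmDeriv (E := E) q₀ z).inverse
      (leftDeriv ((extChartAt 𝓘(ℝ, E) q₀).symm z) v)) =ᶠ[𝓝 (extChartAt 𝓘(ℝ, E) q₀ q₀)]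
    fun z => leftFrame q₀ z v := by
  filter_upwards [extChartAt_target_mem_nhds (I := 𝓘(ℝ, E)) q₀] with z hz
  have hq := (extChartAt 𝓘(ℝ, E) q₀).map_target hz
  have h1 := chartDeriv_comp_chartSymmDeriv (E := E) hq
  have h2 := chartSymmDeriv_comp_chartDeriv (E := E) hq
  rw [(extChartAt 𝓘(ℝ, E) q₀).right_inv hz] at h1 h2
  rw [ContinuousLinearMap.inverse_eq h2 h1]
  rfl

/-- The preferred chart at q₀ has identity derivative at q₀, so the manifold bracket there is the
vector-space bracket of the fields z ↦ M(z) v and z ↦ M(z) w, with M the frame. -/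
theorem mlieBracket_leftInvariant (q₀ : G) (v w : E) :
    VectorField.mlieBracket 𝓘(ℝ, E) (mulInvariantVectorField (I := 𝓘(ℝ, E)) (G := G) v)
      (mulInvariantVectorField w) q₀ =
    (fderiv ℝ (leftFrame (E := E) q₀) (extChartAt 𝓘(ℝ, E) q₀ q₀) (leftDeriv (E := E) q₀ v) w -
      fderiv ℝ (leftFrame (E := E) q₀) (extChartAt 𝓘(ℝ, E) q₀ q₀)
        (leftDeriv (E := E) q₀ w) v : E) := by
  rw [← VectorField.mlieBracketWithin_univ, VectorField.mlieBracketWithin_apply]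
  have e : ∀ y : E, (chartDeriv (E := E) q₀ q₀).inverse y = y := by
    intro y
    rw [chartDeriv_self, ContinuousLinearMap.inverse_id]
    rfl
  refine (e _).trans ?_
  rw [ModelWithCorners.range_eq_univ]
  simp only [Set.preimage_univ, Set.inter_univ, VectorField.mpullbackWithin_univ]
  change VectorField.lieBracketWithin ℝ
    (fun z : E => (chartSymmDeriv (E := E) q₀ z).inverse
      (leftDeriv (E := E) ((extChartAt 𝓘(ℝ, E) q₀).symm z) v))
    (fun z : E => (chartSymmDeriv (E := E) q₀ z).inverse
      (leftDeriv (E := E) ((extChartAt 𝓘(ℝ, E) q₀).symm z) w)) Set.univ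
    (extChartAt 𝓘(ℝ, E) q₀ q₀) = _
  rw [VectorField.lieBracketWithin_univ]
  refine (Filter.EventuallyEq.lieBracket_vectorField_eq (mpullback_chart_symm_eventuallyEq q₀ v)
    (mpullback_chart_symm_eventuallyEq q₀ w)).trans ?_
  have hd : ∀ u : E, fderiv ℝ (fun z => leftFrame (E := E) q₀ z u) (extChartAt 𝓘(ℝ, E) q₀ q₀) =
      (fderiv ℝ (leftFrame q₀) (extChartAt 𝓘(ℝ, E) q₀ q₀)).flip u := by
    intro u
    have := (differentiableAt_leftFrame (E := E) q₀).hasFDerivAt.clm_apply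
      (hasFDerivAt_const u _)
    rw [this.fderiv]
    ext
    simp
  refine (congrArg₂ (fun (a b : E →L[ℝ] E) => a (leftFrame q₀ (extChartAt 𝓘(ℝ, E) q₀ q₀) v) -
    b (leftFrame q₀ (extChartAt 𝓘(ℝ, E) q₀ q₀) w)) (hd w) (hd v)).trans ?_
  rw [leftFrame_self]
  rfl

/-- The structure equation of the frame. The bracket of left-invariant fields is left-invariant, so
its value at q₀ is the translate of its value at 1, although the two are computed in different
charts. -/
theorem leftDeriv_bracketCLM [CompleteSpace E] (q₀ : G) (v w : E) :
    leftDeriv q₀ (bracketCLM E G v w) =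
    fderiv ℝ (leftFrame q₀) (extChartAt 𝓘(ℝ, E) q₀ q₀) (leftDeriv q₀ v) w -
      fderiv ℝ (leftFrame q₀) (extChartAt 𝓘(ℝ, E) q₀ q₀) (leftDeriv q₀ w) v := by
  have h1 := mlieBracket_leftInvariant (E := E) q₀ v w
  have h2 := mlieBracket_leftInvariant (E := E) (1 : G) v w
  have h3 := congrFun (mulInvariantVector_mlieBracket (I := 𝓘(ℝ, E)) (G := G) v w) q₀
  refine Eq.trans ?_ (h3.trans h1)
  refine congrArg (leftDeriv (E := E) q₀) (Eq.trans ?_ h2.symm)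
  rw [leftDeriv_one]
  rfl

end Bracket

/-! ### The differential of the adjoint representation -/

section Adjoint

variable {E : Type*} [NormedAddCommGroup E] [NormedSpace ℝ E]
  {G : Type*} [TopologicalSpace G] [ChartedSpace E G] [Group G]

/-- The adjoint action as an endomorphism of the model space. -/
def adDeriv (g : G) : E →L[ℝ] E := adjointAction E g

/-- The right-invariant frame in the chart at `1`. -/
def rightFrame (G : Type*) [TopologicalSpace G] [ChartedSpace E G] [Group G] (z : E) : E →L[ℝ] E :=
  fderiv ℝ (fun y => mulChart (E := E) (1 : G) (y, z)) (extChartAt 𝓘(ℝ, E) (1 : G) 1)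

theorem rightFrame_one :
    rightFrame G (extChartAt 𝓘(ℝ, E) (1 : G) 1) = ContinuousLinearMap.id ℝ E := by
  have h : (fun y => mulChart (E := E) (1 : G) (y, extChartAt 𝓘(ℝ, E) (1 : G) 1)) =ᶠ[𝓝
      (extChartAt 𝓘(ℝ, E) (1 : G) 1)] id := by
    filter_upwards [extChartAt_target_mem_nhds (I := 𝓘(ℝ, E)) (1 : G)] with y hy
    simp only [mulChart, extChartAt_to_inv, mul_one, id]
    exact (extChartAt 𝓘(ℝ, E) (1 : G)).right_inv hy
  rw [rightFrame, h.fderiv_eq, fderiv_id]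

variable [LieGroup 𝓘(ℝ, E) ∞ G]

theorem hasMFDerivAt_conj (g : G) :
    HasMFDerivAt 𝓘(ℝ, E) 𝓘(ℝ, E) (fun x : G => g * x * g⁻¹) 1 (adDeriv (E := E) g) := by
  have h : ContMDiff 𝓘(ℝ, E) 𝓘(ℝ, E) ∞ (fun x : G => g * x * g⁻¹) :=
    (contMDiff_const.mul contMDiff_id).mul contMDiff_const
  exact (h.mdifferentiable (by simp)).mdifferentiableAt.hasMFDerivAt

theorem adDeriv_one : adDeriv (1 : G) = ContinuousLinearMap.id ℝ E := by
  have h := hasMFDerivAt_conj (E := E) (1 : G)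
  have h' : (fun x : G => 1 * x * 1⁻¹) = id := by ext x; simp
  rw [h'] at h
  have h1 : HasMFDerivAt 𝓘(ℝ, E) 𝓘(ℝ, E) (id : G → G) 1 (ContinuousLinearMap.id ℝ E) :=
    hasMFDerivAt_id 1
  exact hasMFDerivAt_unique h h1

theorem hasFDerivAt_conj_chart (g : G) :
    HasFDerivAt (fun y => extChartAt 𝓘(ℝ, E) (1 : G)
      (g * (extChartAt 𝓘(ℝ, E) (1 : G)).symm y * g⁻¹)) (adDeriv (E := E) g)
      (extChartAt 𝓘(ℝ, E) (1 : G) 1) := by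
  refine hasMFDerivAt_iff_hasFDerivAt.1 ?_
  have h1 := hasMFDerivAt_chart_symm (mem_extChartAt_target (I := 𝓘(ℝ, E)) (1 : G))
  rw [chartSymmDeriv_self] at h1
  have h2 : HasMFDerivAt 𝓘(ℝ, E) 𝓘(ℝ, E) (fun x : G => g * x * g⁻¹)
      ((extChartAt 𝓘(ℝ, E) (1 : G)).symm (extChartAt 𝓘(ℝ, E) (1 : G) 1)) (adDeriv (E := E) g) := by
    rw [extChartAt_to_inv]
    exact hasMFDerivAt_conj g
  have h3 : HasMFDerivAt 𝓘(ℝ, E) 𝓘(ℝ, E) (extChartAt 𝓘(ℝ, E) (1 : G))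
      (g * (extChartAt 𝓘(ℝ, E) (1 : G)).symm (extChartAt 𝓘(ℝ, E) (1 : G) 1) * g⁻¹)
      (ContinuousLinearMap.id ℝ E) := by
    rw [extChartAt_to_inv, mul_one, mul_inv_cancel]
    have := hasMFDerivAt_chart (mem_extChartAt_source (I := 𝓘(ℝ, E)) (1 : G))
    rwa [chartDeriv_self] at this
  have h4 := h2.comp (extChartAt 𝓘(ℝ, E) (1 : G) 1) h1
  exact HasMFDerivAt.comp (extChartAt 𝓘(ℝ, E) (1 : G) 1) (f := fun y =>
    g * (extChartAt 𝓘(ℝ, E) (1 : G)).symm y * g⁻¹) h3 h4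

/-- Differentiate g y = (g y g⁻¹) g with respect to y at the identity. -/
theorem leftFrame_eq_rightFrame_comp_adDeriv :
    ∀ᶠ z in 𝓝 (extChartAt 𝓘(ℝ, E) (1 : G) 1), leftFrame (1 : G) z =
      (rightFrame G z).comp (adDeriv ((extChartAt 𝓘(ℝ, E) (1 : G)).symm z)) := by
  have hd : ∀ᶠ z in 𝓝 (extChartAt 𝓘(ℝ, E) (1 : G) 1),
      DifferentiableAt ℝ (mulChart (E := E) (1 : G)) (extChartAt 𝓘(ℝ, E) (1 : G) 1, z) := by
    have h1 := ((contDiffAt_mulChart (E := E) (1 : G)).of_le (m := 1) (by simp)).eventually (by simp)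
    have h2 : ContinuousAt (fun z : E => (extChartAt 𝓘(ℝ, E) (1 : G) 1, z))
      (extChartAt 𝓘(ℝ, E) (1 : G) 1) := by fun_prop
    filter_upwards [h2.eventually h1] with z hz
    exact hz.differentiableAt (by simp)
  filter_upwards [hd, extChartAt_target_mem_nhds (I := 𝓘(ℝ, E)) (1 : G)] with z hz hzt
  set g := (extChartAt 𝓘(ℝ, E) (1 : G)).symm z with hg
  have h1 := hasFDerivAt_mulChart_snd (E := E) hzt
  have hc := hasFDerivAt_conj_chart (E := E) g
  have hca : extChartAt 𝓘(ℝ, E) (1 : G)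
      (g * (extChartAt 𝓘(ℝ, E) (1 : G)).symm (extChartAt 𝓘(ℝ, E) (1 : G) 1) * g⁻¹) =
      extChartAt 𝓘(ℝ, E) (1 : G) 1 := by
    rw [extChartAt_to_inv, mul_one, mul_inv_cancel]
  have hz' : DifferentiableAt ℝ (fun y => mulChart (E := E) (1 : G) (y, z))
      (extChartAt 𝓘(ℝ, E) (1 : G) 1) := by
    have : DifferentiableAt ℝ (fun y : E => (y, z)) (extChartAt 𝓘(ℝ, E) (1 : G) 1) := by fun_prop
    exact DifferentiableAt.comp (g := mulChart (E := E) (1 : G)) _ hz this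
  have h2 := hz'.hasFDerivAt
  rw [← hca] at h2
  have h3 := HasFDerivAt.comp (g := fun y => mulChart (E := E) (1 : G) (y, z))
    (extChartAt 𝓘(ℝ, E) (1 : G) 1) h2 hc
  rw [hca] at h3
  refine h1.unique (h3.congr_of_eventuallyEq ?_)
  have hcont : ContinuousAt (fun y => g * (extChartAt 𝓘(ℝ, E) (1 : G)).symm y * g⁻¹)
      (extChartAt 𝓘(ℝ, E) (1 : G) 1) := by
    have : IsTopologicalGroup G := topologicalGroup_of_lieGroup 𝓘(ℝ, E) ∞
    exact (continuousAt_const.mul (continuousAt_extChartAt_symm (I := 𝓘(ℝ, E)) (1 : G))).mul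
      continuousAt_const
  have hsrc : (extChartAt 𝓘(ℝ, E) (1 : G)).source ∈
      𝓝 (g * (extChartAt 𝓘(ℝ, E) (1 : G)).symm (extChartAt 𝓘(ℝ, E) (1 : G) 1) * g⁻¹) := by
    rw [extChartAt_to_inv, mul_one, mul_inv_cancel]
    exact extChartAt_source_mem_nhds _
  filter_upwards [hcont hsrc] with y hy
  simp only [mulChart, Function.comp_def]
  rw [(extChartAt 𝓘(ℝ, E) (1 : G)).left_inv hy, ← hg]
  simp

theorem eventually_mulChart_differentiableAt :
    ∀ᶠ p in 𝓝 (extChartAt 𝓘(ℝ, E) (1 : G) 1, extChartAt 𝓘(ℝ, E) (1 : G) 1),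
      DifferentiableAt ℝ (mulChart (E := E) (1 : G)) p := by
  have h1 := ((contDiffAt_mulChart (E := E) (1 : G)).of_le (m := 1) (by simp)).eventually (by simp)
  filter_upwards [h1] with z hz
  exact hz.differentiableAt (by simp)

theorem differentiableAt_fderiv_mulChart :
    DifferentiableAt ℝ (fderiv ℝ (mulChart (E := E) (1 : G)))
      (extChartAt 𝓘(ℝ, E) (1 : G) 1, extChartAt 𝓘(ℝ, E) (1 : G) 1) :=
  ((contDiffAt_mulChart (E := E) (1 : G)).fderiv_right (m := ∞) (by simp)).differentiableAt
    (by simp)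

/-- Both frames are first partial derivatives of the multiplication in the chart. Their derivatives
at the identity are the same mixed second partial with the arguments exchanged, by symmetry of the
second derivative. -/
theorem hasFDerivAt_rightFrame :
    HasFDerivAt (rightFrame (E := E) G)
      (fderiv ℝ (leftFrame (1 : G)) (extChartAt 𝓘(ℝ, E) (1 : G) 1)).flip
      (extChartAt 𝓘(ℝ, E) (1 : G) 1) := by
  set a := extChartAt 𝓘(ℝ, E) (1 : G) 1 with ha
  set m := mulChart (E := E) (1 : G) with hm
  have hD := (differentiableAt_fderiv_mulChart (E := E) (G := G)).hasFDerivAt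
  rw [← ha, ← hm] at hD
  set D := fderiv ℝ (fderiv ℝ m) (a, a) with hDD
  have hsymm : IsSymmSndFDerivAt ℝ m (a, a) :=
    (contDiffAt_mulChart (E := E) (1 : G)).isSymmSndFDerivAt (by
      rw [minSmoothness_of_isRCLikeNormedField]
      exact ENat.LEInfty.out)
  have hR : ∀ᶠ z in 𝓝 a, rightFrame (E := E) G z =
      (fderiv ℝ m (a, z)).comp (ContinuousLinearMap.inl ℝ E E) := by
    have h2 : ContinuousAt (fun z : E => (a, z)) a := by fun_prop
    filter_upwards [h2.eventually (eventually_mulChart_differentiableAt (E := E) (G := G))] with z hz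
    have : HasFDerivAt (fun y : E => (y, z)) (ContinuousLinearMap.inl ℝ E E) a :=
      hasFDerivAt_prodMk_left a z
    exact (HasFDerivAt.comp (g := m) a hz.hasFDerivAt this).fderiv
  have hL : ∀ᶠ z in 𝓝 a, leftFrame (E := E) (1 : G) z =
      (fderiv ℝ m (z, a)).comp (ContinuousLinearMap.inr ℝ E E) := by
    have h2 : ContinuousAt (fun z : E => (z, a)) a := by fun_prop
    filter_upwards [h2.eventually (eventually_mulChart_differentiableAt (E := E) (G := G)),
      leftFrame_eventuallyEq (E := E) (1 : G)] with z hz hz'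
    have : HasFDerivAt (fun y : E => (z, y)) (ContinuousLinearMap.inr ℝ E E) a :=
      hasFDerivAt_prodMk_right z a
    rw [← hz']
    exact (HasFDerivAt.comp (g := m) a hz.hasFDerivAt this).fderiv
  have hR' := (HasFDerivAt.comp (g := fderiv ℝ m) a hD
    (hasFDerivAt_prodMk_right a a)).clm_comp (hasFDerivAt_const (ContinuousLinearMap.inl ℝ E E) a)
  have hL' := (HasFDerivAt.comp (g := fderiv ℝ m) (f := fun e => (e, a)) a hD
    (hasFDerivAt_prodMk_left a a)).clm_comp (hasFDerivAt_const (ContinuousLinearMap.inr ℝ E E) a)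
  have hL'' := (hL'.congr_of_eventuallyEq hL).fderiv
  refine (hR'.congr_of_eventuallyEq hR).congr_fderiv ?_
  ext v w
  rw [hL'']
  simpa using hsymm.eq (0, v) (w, 0)

/-- The differential of the adjoint representation at the identity is the Lie bracket. -/
theorem hasFDerivAt_adDeriv_chart [CompleteSpace E] :
    HasFDerivAt (fun z => adDeriv (E := E) ((extChartAt 𝓘(ℝ, E) (1 : G)).symm z))
      (bracketCLM E G) (extChartAt 𝓘(ℝ, E) (1 : G) 1) := by
  set a := extChartAt 𝓘(ℝ, E) (1 : G) 1 with ha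
  have hR := hasFDerivAt_rightFrame (E := E) (G := G)
  have hLd := (differentiableAt_leftFrame (E := E) (1 : G)).hasFDerivAt
  rw [← ha] at hR hLd
  have hR1 : rightFrame G a = ContinuousLinearMap.id ℝ E := rightFrame_one
  have hunit : IsUnit (rightFrame (E := E) G a) := by
    rw [hR1]
    exact isUnit_one
  obtain ⟨u, hu⟩ := hunit
  have hu1 : u = 1 := Units.ext (hu.trans hR1)
  have hinv := hasFDerivAt_ringInverse (𝕜 := ℝ) u
  rw [hu] at hinv
  have hcomp := (hinv.comp a hR).clm_comp hLd
  -- Near 1, Ad is R⁻¹ L with R and L the right and left frames. Both are the identity at 1, so the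
  -- derivative of Ad there is DL - DR, and DR is the flip of DL.
  have hev : (fun z => adDeriv (E := E) ((extChartAt 𝓘(ℝ, E) (1 : G)).symm z)) =ᶠ[𝓝 a]
      fun z => ((Ring.inverse ∘ rightFrame (E := E) G) z).comp (leftFrame (1 : G) z) := by
    have hopen : ∀ᶠ z in 𝓝 a, IsUnit (rightFrame (E := E) G z) := by
      refine hR.continuousAt.eventually ?_
      rw [← hu]
      exact Units.nhds u
    filter_upwards [leftFrame_eq_rightFrame_comp_adDeriv (E := E) (G := G), hopen] with z hz hz'
    rw [hz]
    exact (Ring.inverse_mul_cancel_left _ _ hz').symm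
  refine (hcomp.congr_of_eventuallyEq hev).congr_fderiv ?_
  ext v w
  have hL1 : leftFrame (1 : G) a = ContinuousLinearMap.id ℝ E := by
    rw [ha, leftFrame_self, leftDeriv_one]
  subst hu1
  have hinv1 : Ring.inverse (ContinuousLinearMap.id ℝ E) = ContinuousLinearMap.id ℝ E :=
    Ring.inverse_one (E →L[ℝ] E)
  rw [bracketCLM, ← ha]
  simp [hL1, hR1, hinv1, sub_eq_add_neg]

end Adjoint

/-! ### Left translations as isomorphisms of tangent spaces -/

section LeftDeriv

variable {E : Type*} [NormedAddCommGroup E] [NormedSpace ℝ E]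
  {G : Type*} [TopologicalSpace G] [ChartedSpace E G] [Group G] [LieGroup 𝓘(ℝ, E) ∞ G]

/-- The differential at `q` of the left translation by `g`, as an endomorphism of the model
space. -/
def mulLeftDeriv (g q : G) : E →L[ℝ] E := mfderiv 𝓘(ℝ, E) 𝓘(ℝ, E) (fun x : G => g * x) q

theorem hasMFDerivAt_mul_left (g q : G) :
    HasMFDerivAt 𝓘(ℝ, E) 𝓘(ℝ, E) (fun x : G => g * x) q (mulLeftDeriv (E := E) g q) :=
  ((contMDiff_mul_left (I := 𝓘(ℝ, E)) (n := ∞) (a := g)).mdifferentiable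
    (by simp)).mdifferentiableAt.hasMFDerivAt

theorem mulLeftDeriv_comp_leftDeriv (g q : G) :
    (mulLeftDeriv g q).comp (leftDeriv (E := E) q) = leftDeriv (g * q) := by
  have h1 := hasMFDerivAt_mul_left_one (E := E) q
  have h2 : HasMFDerivAt 𝓘(ℝ, E) 𝓘(ℝ, E) (fun x : G => g * x) (q * 1)
      (mulLeftDeriv (E := E) g q) := by
    rw [mul_one]
    exact hasMFDerivAt_mul_left g q
  have h3 := HasMFDerivAt.comp (1 : G) h2 h1
  have h4 : (fun x : G => g * x) ∘ (fun x : G => q * x) = fun x => g * q * x := by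
    ext x
    simp [mul_assoc]
  rw [h4] at h3
  exact hasMFDerivAt_unique h3 (hasMFDerivAt_mul_left_one (E := E) (g * q))

theorem leftDeriv_comp_mulLeftDeriv (g : G) :
    (leftDeriv g).comp (mulLeftDeriv (E := E) g⁻¹ g) = ContinuousLinearMap.id ℝ E := by
  have h1 : HasMFDerivAt 𝓘(ℝ, E) 𝓘(ℝ, E) (fun x : G => g * x) (g⁻¹ * g)
      (leftDeriv (E := E) g) := by
    rw [inv_mul_cancel]
    exact hasMFDerivAt_mul_left_one g
  have h2 := HasMFDerivAt.comp g h1 (hasMFDerivAt_mul_left (E := E) g⁻¹ g)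
  have h4 : (fun x : G => g * x) ∘ (fun x : G => g⁻¹ * x) = id := by
    ext x
    simp
  rw [h4] at h2
  exact hasMFDerivAt_unique h2 (hasMFDerivAt_id g)

/-- The differential at the identity of the left translation by `g`, as an isomorphism. -/
def leftDerivEquiv (g : G) : E ≃L[ℝ] E :=
  ContinuousLinearEquiv.equivOfInverse (leftDeriv g) (mulLeftDeriv g⁻¹ g)
    (fun x => by
      have h := mulLeftDeriv_comp_leftDeriv (E := E) g⁻¹ g
      rw [inv_mul_cancel, leftDeriv_one] at h
      exact DFunLike.congr_fun h x)
    (fun x => DFunLike.congr_fun (leftDeriv_comp_mulLeftDeriv (E := E) g) x)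

theorem leftDerivEquiv_apply (g : G) (v : E) : leftDerivEquiv g v = leftDeriv g v := rfl

end LeftDeriv

/-! ### Quadratic functions of the momentum in a moving frame -/

section Calculus

variable {E : Type*} [NormedAddCommGroup E] [NormedSpace ℝ E]

/-- The differential of a quadratic function of the momentum in a moving frame. -/
theorem hasFDerivAt_quadratic_frame (b : E ≃L[ℝ] (E →L[ℝ] ℝ)) (hb : ∀ v w, b v w = b w v)
    (S : E →L[ℝ] E) (hS : ∀ v w, b v (S w) = b (S v) w) (M : E → E →L[ℝ] E) (M' : E →L[ℝ] E →L[ℝ] E)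
    (z : E) (p : E →L[ℝ] ℝ) (hM : HasFDerivAt M M' z) :
    ∃ f : E × (E →L[ℝ] ℝ) →L[ℝ] ℝ,
      HasFDerivAt (fun y : E × (E →L[ℝ] ℝ) => (1 / 2 : ℝ) *
        b (b.symm (y.2.comp (M y.1))) (S (b.symm (y.2.comp (M y.1))))) f (z, p) ∧
      ∀ e β, f (e, β) = β (M z (S (b.symm (p.comp (M z))))) +
        p (M' e (S (b.symm (p.comp (M z))))) := by
  set x := b.symm (p.comp (M z)) with hx
  have h1 : HasFDerivAt (fun y : E × (E →L[ℝ] ℝ) => M y.1)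
      (M'.comp (ContinuousLinearMap.fst ℝ E (E →L[ℝ] ℝ))) (z, p) :=
    HasFDerivAt.comp (g := M) (z, p) hM hasFDerivAt_fst
  have h2 := (hasFDerivAt_snd (𝕜 := ℝ) (p := ((z, p) : E × (E →L[ℝ] ℝ)))).clm_comp h1
  have h3 := (b.symm : (E →L[ℝ] ℝ) →L[ℝ] E).hasFDerivAt.comp (z, p) h2
  have h5 := ((b : E →L[ℝ] (E →L[ℝ] ℝ)).hasFDerivAt.comp (z, p) h3).clm_apply
    (S.hasFDerivAt.comp (z, p) h3)
  refine ⟨_, h5.const_mul (1 / 2 : ℝ), ?_⟩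
  intro e β
  -- Symmetry of S makes the two terms of the product rule equal, which absorbs the factor ½.
  have h7 : ∀ v, b x (S v) = b v (S x) := fun v => by rw [hS, hb]
  simp [← hx, h7]
  ring

end Calculus

/-! ### The scalar product and the left-trivialized momentum -/

section Form

variable {E : Type*} [NormedAddCommGroup E] [NormedSpace ℝ E]
  {G : Type*} [TopologicalSpace G] [ChartedSpace E G] [Group G]

namespace AdInvariantScalarProduct

variable (B : AdInvariantScalarProduct E G)

/-- The scalar product, as a bilinear form on the model space. -/
def formCLM : E →L[ℝ] E →L[ℝ] ℝ := B.form

theorem formCLM_symm (v w : E) : B.formCLM v w = B.formCLM w v := B.symm v w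

variable [FiniteDimensional ℝ E]

/-- The isomorphism of the Lie algebra with its dual given by the scalar product. -/
def formEquiv : E ≃L[ℝ] (E →L[ℝ] ℝ) :=
  have hi : Function.Injective B.formCLM.toLinearMap := by
    rw [← LinearMap.ker_eq_bot, LinearMap.ker_eq_bot']
    intro v hv
    by_contra hne
    exact (B.pos v hne).ne' (DFunLike.congr_fun hv v)
  (LinearEquiv.ofInjectiveOfFinrankEq B.formCLM.toLinearMap hi (by
    rw [← (LinearMap.toContinuousLinearMap : (E →ₗ[ℝ] ℝ) ≃ₗ[ℝ] _).finrank_eq]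
    exact (Subspace.dual_finrank_eq (K := ℝ) (V := E)).symm)).toContinuousLinearEquiv

theorem formEquiv_apply (v w : E) : B.formEquiv v w = B.formCLM v w := rfl

theorem formEquiv_symm (v w : E) : B.formEquiv v w = B.formEquiv w v := B.symm v w

/-- The left-trivialized momentum, as a vector of the model space. -/
def momentum (x : PhaseSpace E G) : E := B.toLieAlgebra x

theorem momentum_eq (x : PhaseSpace E G) :
    B.momentum x = B.formEquiv.symm (ContinuousLinearMap.comp (x.2 : E →L[ℝ] ℝ)
      (leftDeriv (E := E) x.1)) := by
  have h : B.formCLM.inverse = B.formEquiv.symm := by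
    have h' : B.formCLM = B.formEquiv := rfl
    rw [h']
    exact ContinuousLinearMap.inverse_equiv _
  exact DFunLike.congr_fun h (ContinuousLinearMap.comp (x.2 : E →L[ℝ] ℝ)
      (leftDeriv (E := E) x.1))

theorem formEquiv_momentum (x : PhaseSpace E G) (w : E) :
    B.formEquiv (B.momentum x) w = x.2 (leftDeriv (E := E) x.1 w) := by
  rw [momentum_eq, ContinuousLinearEquiv.apply_symm_apply]
  rfl

end AdInvariantScalarProduct

end Form

section Invariance

variable {E : Type*} [NormedAddCommGroup E] [NormedSpace ℝ E] [FiniteDimensional ℝ E]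
  {G : Type*} [TopologicalSpace G] [ChartedSpace E G] [Group G] [LieGroup 𝓘(ℝ, E) ∞ G]

namespace AdInvariantScalarProduct

variable (B : AdInvariantScalarProduct E G)

/-- Differentiate the Ad-invariance of the form at the identity in the direction u. -/
theorem formCLM_bracket (u v w : E) :
    B.formCLM (bracketCLM E G u v) w + B.formCLM v (bracketCLM E G u w) = 0 := by
  have : CompleteSpace E := FiniteDimensional.complete ℝ E
  have hA := hasFDerivAt_adDeriv_chart (E := E) (G := G)
  have hv := hA.clm_apply (hasFDerivAt_const v _)
  have hw := hA.clm_apply (hasFDerivAt_const w _)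
  have h1 := (B.formCLM.hasFDerivAt.comp _ hv).clm_apply hw
  have h2 : (fun z : E => (B.formCLM ∘ fun y => (adDeriv (E := E)
      ((extChartAt 𝓘(ℝ, E) (1 : G)).symm y)) v) z
      ((adDeriv (E := E) ((extChartAt 𝓘(ℝ, E) (1 : G)).symm z)) w)) =
      fun _ => B.formCLM v w := by
    ext z
    exact B.ad_invariant _ v w
  rw [h2] at h1
  have h3 := DFunLike.congr_fun (h1.unique (hasFDerivAt_const _ _)) u
  simpa [adDeriv_one, add_comm] using h3

theorem formCLM_bracket_assoc (u v w : E) :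
    B.formCLM (bracketCLM E G u v) w = B.formCLM u (bracketCLM E G v w) := by
  have h := B.formCLM_bracket v u w
  rw [bracketCLM_swap]
  simp only [map_neg, neg_apply]
  linarith

end AdInvariantScalarProduct

end Invariance

/-! ### The canonical equations in the left trivialization -/

section Mechanics

variable {E : Type*} [NormedAddCommGroup E] [NormedSpace ℝ E]
  {G : Type*} [TopologicalSpace G] [ChartedSpace E G]

theorem hasMFDerivAt_curve_iff {g : ℝ → G} {t : ℝ} {v : E} :
    HasMFDerivAt 𝓘(ℝ, ℝ) 𝓘(ℝ, E) g t (ContinuousLinearMap.smulRight (1 : ℝ →L[ℝ] ℝ) v) ↔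
      ContinuousAt g t ∧ HasDerivAt (fun s => extChartAt 𝓘(ℝ, E) (g t) (g s)) v t := by
  rw [HasMFDerivAt]
  refine and_congr_right fun _ => ?_
  rw [ModelWithCorners.range_eq_univ]
  exact hasFDerivWithinAt_univ.trans Iff.rfl

theorem covectorCoords_self [IsManifold 𝓘(ℝ, E) 1 G] (q : G)
    (F : TangentSpace 𝓘(ℝ, E) q →L[ℝ] ℝ) :
    covectorCoords q ⟨q, F⟩ = (F : E →L[ℝ] ℝ) := by
  have h := chartSymmDeriv_self (E := E) q
  ext v
  exact congrArg F (DFunLike.congr_fun h v)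

variable [Group G]

theorem isUnit_leftFrame [LieGroup 𝓘(ℝ, E) ∞ G] (q₀ : G) :
    IsUnit (leftFrame q₀ (extChartAt 𝓘(ℝ, E) q₀ q₀)) := by
  rw [leftFrame_self]
  exact ⟨ContinuousLinearEquiv.toUnit (leftDerivEquiv q₀), rfl⟩

/-- The chart derivatives cancel, so the momentum can be read off from the canonical coordinates of
any chart around the point. -/
theorem covectorCoords_comp_leftFrame [IsManifold 𝓘(ℝ, E) 1 G] {q₀ : G} (x : PhaseSpace E G)
    (hx : x.1 ∈ (extChartAt 𝓘(ℝ, E) q₀).source) :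
    (covectorCoords q₀ x).comp (leftFrame q₀ (extChartAt 𝓘(ℝ, E) q₀ x.1)) =
      ContinuousLinearMap.comp (x.2 : E →L[ℝ] ℝ) (leftDeriv (E := E) x.1) := by
  have h := chartSymmDeriv_comp_chartDeriv (E := E) hx
  rw [leftFrame, (extChartAt 𝓘(ℝ, E) q₀).left_inv hx]
  ext v
  exact congrArg x.2 (DFunLike.congr_fun h (leftDeriv (E := E) x.1 v))

variable [FiniteDimensional ℝ E] [LieGroup 𝓘(ℝ, E) ∞ G] (B : AdInvariantScalarProduct E G)

theorem hasFDerivAt_leftExtend (S : E →L[ℝ] E)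
    (hS : ∀ v w, B.formCLM v (S w) = B.formCLM (S v) w) (x : PhaseSpace E G) :
    ∃ f : E × (E →L[ℝ] ℝ) →L[ℝ] ℝ,
      HasFDerivAt (fun z => B.leftExtend (B.reducedHamiltonian S) (ofCanonicalCoords x.1 z)) f
        (canonicalCoords x.1 x) ∧
      ∀ e β, f (e, β) = β (leftDeriv x.1 (S (B.momentum x))) +
        covectorCoords x.1 x (fderiv ℝ (leftFrame x.1) (extChartAt 𝓘(ℝ, E) x.1 x.1) e
          (S (B.momentum x))) := by
  obtain ⟨f, hf, hf'⟩ := hasFDerivAt_quadratic_frame B.formEquiv B.formEquiv_symm S hS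
    (leftFrame (E := E) x.1) _ (extChartAt 𝓘(ℝ, E) x.1 x.1) (covectorCoords x.1 x)
    (differentiableAt_leftFrame (E := E) x.1).hasFDerivAt
  rw [covectorCoords_comp_leftFrame x (mem_extChartAt_source x.1), ← B.momentum_eq] at hf'
  refine ⟨f, ?_, ?_⟩
  · have : (fun z => B.leftExtend (B.reducedHamiltonian S) (ofCanonicalCoords x.1 z)) =
        fun y : E × (E →L[ℝ] ℝ) => (1 / 2 : ℝ) *
        B.formEquiv (B.formEquiv.symm (y.2.comp (leftFrame x.1 y.1)))
          (S (B.formEquiv.symm (y.2.comp (leftFrame x.1 y.1)))) := by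
      ext y
      change B.reducedHamiltonian S (B.momentum _) = _
      rw [B.momentum_eq]
      rfl
    rw [this]
    exact hf
  · intro e β
    rw [hf', leftFrame_self]

theorem hasDerivAt_momentum {γ : ℝ → PhaseSpace E G} {t : ℝ}
    (hc : ContinuousAt (fun s => (γ s).1) t) {q' : E} {p' : E →L[ℝ] ℝ}
    (hq : HasDerivAt (fun s => extChartAt 𝓘(ℝ, E) (γ t).1 (γ s).1) q' t)
    (hp : HasDerivAt (fun s => covectorCoords (γ t).1 (γ s)) p' t) :
    HasDerivAt (fun s => B.momentum (γ s))
      (B.formEquiv.symm (p'.comp (leftDeriv (γ t).1) + (covectorCoords (γ t).1 (γ t)).comp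
        (fderiv ℝ (leftFrame (γ t).1) (extChartAt 𝓘(ℝ, E) (γ t).1 (γ t).1) q'))) t := by
  have hM := (differentiableAt_leftFrame (E := E) (γ t).1).hasFDerivAt.comp_hasDerivAt t hq
  have h1 := hp.clm_comp hM
  have h2 := (B.formEquiv.symm : (E →L[ℝ] ℝ) →L[ℝ] E).hasFDerivAt.comp_hasDerivAt t h1
  have hev : (fun s => B.momentum (γ s)) =ᶠ[𝓝 t] fun s =>
      B.formEquiv.symm ((covectorCoords (γ t).1 (γ s)).comp
        (leftFrame (γ t).1 (extChartAt 𝓘(ℝ, E) (γ t).1 (γ s).1))) := by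
    filter_upwards [hc (extChartAt_source_mem_nhds (I := 𝓘(ℝ, E)) (γ t).1)] with s hs
    rw [covectorCoords_comp_leftFrame (γ s) hs, B.momentum_eq]
  refine (h2.congr_of_eventuallyEq hev).congr_deriv ?_
  simp only [Function.comp_apply, leftFrame_self]
  rfl

/-- With M the frame, pairing with w leaves p(DM(g·u) w - DM(g·w) u) plus the force. By the
structure equation this difference is p(g·[u, w]) = ⟨x, [u, w]⟩ = ⟨[x, u], w⟩. -/
theorem reduced_force_eq {x : PhaseSpace E G} (u : E) (p' F : E →L[ℝ] ℝ)
    (hp : ∀ e, p' e = -covectorCoords x.1 x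
      (fderiv ℝ (leftFrame x.1) (extChartAt 𝓘(ℝ, E) x.1 x.1) e u) + F e) :
    B.formEquiv.symm (p'.comp (leftDeriv x.1) + (covectorCoords x.1 x).comp
        (fderiv ℝ (leftFrame x.1) (extChartAt 𝓘(ℝ, E) x.1 x.1) (leftDeriv x.1 u))) =
      bracketCLM E G (B.momentum x) u + B.formEquiv.symm (F.comp (leftDeriv x.1)) := by
  have : CompleteSpace E := FiniteDimensional.complete ℝ E
  rw [ContinuousLinearEquiv.symm_apply_eq, map_add, ContinuousLinearEquiv.apply_symm_apply]
  ext w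
  have h1 : B.formEquiv (bracketCLM E G (B.momentum x) u) w =
      covectorCoords x.1 x (leftDeriv x.1 (bracketCLM E G u w)) := by
    rw [B.formEquiv_apply, B.formCLM_bracket_assoc, ← B.formEquiv_apply, B.formEquiv_momentum]
    exact (DFunLike.congr_fun (covectorCoords_self x.1 x.2) _).symm
  simp only [add_apply, ContinuousLinearMap.comp_apply, h1, hp,
    leftDeriv_bracketCLM, map_sub]
  ring

/-- The canonical equations of a left-invariant quadratic Hamiltonian, in the left
trivialization: `g' = g · S x`, `x' = [x, S x] + F`. -/
theorem obeysHamiltonEqAt_iff (S : E →L[ℝ] E)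
    (hS : ∀ v w, B.formCLM v (S w) = B.formCLM (S v) w) (γ : ℝ → PhaseSpace E G) (t : ℝ)
    (F : E →L[ℝ] ℝ) :
    ObeysHamiltonEqAt (B.leftExtend (B.reducedHamiltonian S)) γ t F ↔
      HasMFDerivAt 𝓘(ℝ, ℝ) 𝓘(ℝ, E) (fun s => (γ s).1) t
        (ContinuousLinearMap.smulRight (1 : ℝ →L[ℝ] ℝ)
          (leftDeriv (E := E) (γ t).1 (S (B.momentum (γ t))))) ∧
      HasDerivAt (fun s => B.momentum (γ s))
        (bracketCLM E G (B.momentum (γ t)) (S (B.momentum (γ t))) +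
          B.formEquiv.symm (F.comp (leftDeriv (γ t).1))) t := by
  obtain ⟨f, hf, hf'⟩ := hasFDerivAt_leftExtend B S hS (γ t)
  have hcv := covectorCoords_self (E := E) (γ t).1 F
  rw [hasMFDerivAt_curve_iff]
  unfold ObeysHamiltonEqAt
  rw [hf.fderiv]
  constructor
  · rintro ⟨hc, -, q', p', hd, hq', hp'⟩
    have hq := hd.fst
    have hp := hd.snd
    have hq'' : q' = leftDeriv (γ t).1 (S (B.momentum (γ t))) := by
      refine (SeparatingDual.eq_iff_forall_dual_eq (R := ℝ)).2 fun β => ?_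
      rw [hq', hf']
      simp
    subst hq''
    refine ⟨⟨hc, hq⟩, ?_⟩
    rw [← reduced_force_eq B _ p' F]
    · exact hasDerivAt_momentum B hc hq hp
    · intro e
      rw [hp', hf', hcv]
      simp
  · rintro ⟨⟨hc, hq⟩, hx⟩
    -- The chart components of the covector are ⟨x, ·⟩ ∘ M⁻¹ with M the frame along the curve. M is
    -- invertible near time t and inversion is differentiable.
    obtain ⟨p', hp⟩ : ∃ p', HasDerivAt (fun s => covectorCoords (γ t).1 (γ s)) p' t := by
      have hM := (differentiableAt_leftFrame (E := E) (γ t).1).hasFDerivAt.comp_hasDerivAt t hq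
      obtain ⟨u, hu⟩ := isUnit_leftFrame (E := E) (γ t).1
      have hinv := hasFDerivAt_ringInverse (𝕜 := ℝ) u
      rw [hu] at hinv
      have h1 := hinv.comp_hasDerivAt t hM
      have h2 := ((B.formEquiv : E →L[ℝ] E →L[ℝ] ℝ).hasFDerivAt.comp_hasDerivAt t hx).clm_comp h1
      refine ⟨_, h2.congr_of_eventuallyEq ?_⟩
      have hopen : ∀ᶠ s in 𝓝 t, IsUnit (leftFrame (E := E) (γ t).1
          (extChartAt 𝓘(ℝ, E) (γ t).1 (γ s).1)) := by
        refine hM.continuousAt.eventually ?_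
        rw [Function.comp_apply, ← hu]
        exact Units.nhds u
      filter_upwards [hc (extChartAt_source_mem_nhds (I := 𝓘(ℝ, E)) (γ t).1), hopen] with s hs hs'
      have h3 := covectorCoords_comp_leftFrame (γ s) hs
      have h4 : B.formEquiv (B.momentum (γ s)) =
          ContinuousLinearMap.comp ((γ s).2 : E →L[ℝ] ℝ) (leftDeriv (E := E) (γ s).1) := by
        rw [B.momentum_eq, ContinuousLinearEquiv.apply_symm_apply]
      have h5 := Ring.mul_inverse_cancel _ hs'
      simp only [Function.comp_apply, ContinuousLinearEquiv.coe_coe]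
      rw [h4, ← h3, ContinuousLinearMap.comp_assoc]
      exact (congrArg (ContinuousLinearMap.comp (covectorCoords (γ t).1 (γ s))) h5).symm
    have hx' := hasDerivAt_momentum B hc hq hp
    -- The value that Hamilton's equation prescribes for p'. It yields the same x' as the actual
    -- derivative, and x' determines p' because the left translation is invertible.
    set p'' : E →L[ℝ] ℝ := -((covectorCoords (γ t).1 (γ t)).comp
      ((fderiv ℝ (leftFrame (γ t).1) (extChartAt 𝓘(ℝ, E) (γ t).1 (γ t).1)).flip
        (S (B.momentum (γ t))))) + F with hp''
    have h1 := reduced_force_eq B (x := γ t) (S (B.momentum (γ t))) p'' F (fun e => by simp [p''])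
    have h2 := h1.trans (hx.unique hx')
    rw [B.formEquiv.symm.injective.eq_iff, add_left_inj] at h2
    have h3 : p'' = p' := by
      ext e
      obtain ⟨e', rfl⟩ := (leftDerivEquiv (E := E) (γ t).1).surjective e
      exact DFunLike.congr_fun h2 e'
    subst h3
    refine ⟨hc, hf.differentiableAt, _, _, hq.prodMk hp, ?_, ?_⟩
    · intro β
      rw [hf']
      simp
    · intro e
      rw [hf', hcv]
      simp [p'']

end Mechanics

/-! ### Regularity of the vector field on G × E -/

section Field

variable {E : Type*} [NormedAddCommGroup E] [NormedSpace ℝ E]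
  {G : Type*} [TopologicalSpace G] [ChartedSpace E G]

theorem tangentBundle_mk_congr {q q' : G} (hq : q = q') {v v' : E} (hv : v = v') :
    (Bundle.TotalSpace.mk' E q v : TangentBundle 𝓘(ℝ, E) G) = Bundle.TotalSpace.mk' E q' v' := by
  subst hq hv
  rfl

variable [Group G]

/-- The vector field `(g, x) ↦ (g · ψ x, f x)` on `G × E`. -/
def leftField (ψ f : E → E) (y : G × E) : TangentSpace (𝓘(ℝ, E).prod 𝓘(ℝ, E)) y :=
  ((leftDeriv (E := E) y.1 (ψ y.2), f y.2) : E × E)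

variable [LieGroup 𝓘(ℝ, E) ∞ G]

theorem contMDiff_vertical_inclusion (q : G) :
    ContMDiff 𝓘(ℝ, E) 𝓘(ℝ, E).tangent 1
      (fun v : E => (Bundle.TotalSpace.mk' E q v : TangentBundle 𝓘(ℝ, E) G)) := by
  intro v
  rw [Bundle.contMDiffAt_totalSpace]
  refine ⟨contMDiffAt_const, ?_⟩
  have h : ∀ w : E, (trivializationAt E (TangentSpace 𝓘(ℝ, E)) q
      (Bundle.TotalSpace.mk' E q w : TangentBundle 𝓘(ℝ, E) G)).2 = w := by
    intro w
    exact (tangentBundleCore 𝓘(ℝ, E) G).coordChange_self (achart E q) q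
      (mem_chart_source E q) w
  have h' : (fun w : E => (trivializationAt E (TangentSpace 𝓘(ℝ, E)) q
      (Bundle.TotalSpace.mk' E q w : TangentBundle 𝓘(ℝ, E) G)).2) = id := funext h
  exact contMDiffAt_id.congr_of_eventuallyEq (Filter.Eventually.of_forall h)

theorem mfderiv_mul_inr (q : G) (v : E) :
    (mfderiv (𝓘(ℝ, E).prod 𝓘(ℝ, E)) 𝓘(ℝ, E) (fun p : G × G => p.1 * p.2) (q, 1) :
      E × E →L[ℝ] E) (0, v) = leftDeriv q v := by
  have h1 := (((contMDiff_mul 𝓘(ℝ, E) ∞ (G := G)).mdifferentiable (by simp)) (q, 1)).hasMFDerivAt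
  have h2 := (hasMFDerivAt_const (I := 𝓘(ℝ, E)) (I' := 𝓘(ℝ, E)) q (1 : G)).prodMk
    (hasMFDerivAt_id (I := 𝓘(ℝ, E)) (1 : G))
  have h3 := HasMFDerivAt.comp (1 : G) h1 h2
  exact DFunLike.congr_fun (hasMFDerivAt_unique h3 (hasMFDerivAt_mul_left_one (E := E) q)) v

/-- The vector g·v is the image of (0 at g, v at 1) under the tangent map of the multiplication, so
regularity follows from smoothness of the multiplication. -/
theorem contMDiff_leftField {ψ f : E → E} (hψ : ContDiff ℝ 1 ψ) (hf : ContDiff ℝ 1 f) :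
    ContMDiff (𝓘(ℝ, E).prod 𝓘(ℝ, E)) (𝓘(ℝ, E).prod 𝓘(ℝ, E)).tangent 1
      (fun y : G × E => (⟨y, leftField ψ f y⟩ :
        TangentBundle (𝓘(ℝ, E).prod 𝓘(ℝ, E)) (G × E))) := by
  have hz : ContMDiff (𝓘(ℝ, E).prod 𝓘(ℝ, E)) 𝓘(ℝ, E).tangent 1
      (fun y : G × E => (Bundle.TotalSpace.mk' E y.1 0 : TangentBundle 𝓘(ℝ, E) G)) :=
    (Bundle.contMDiff_zeroSection ℝ (TangentSpace 𝓘(ℝ, E) : G → Type _)).comp contMDiff_fst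
  have hv : ContMDiff (𝓘(ℝ, E).prod 𝓘(ℝ, E)) 𝓘(ℝ, E).tangent 1
      (fun y : G × E => (Bundle.TotalSpace.mk' E (1 : G) (ψ y.2) : TangentBundle 𝓘(ℝ, E) G)) :=
    (contMDiff_vertical_inclusion (1 : G)).comp (hψ.contMDiff.comp contMDiff_snd)
  have hm : ContMDiff (𝓘(ℝ, E).prod 𝓘(ℝ, E)).tangent 𝓘(ℝ, E).tangent 1
      (tangentMap (𝓘(ℝ, E).prod 𝓘(ℝ, E)) 𝓘(ℝ, E) (fun p : G × G => p.1 * p.2)) :=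
    ContMDiff.contMDiff_tangentMap (n := ∞) (contMDiff_mul 𝓘(ℝ, E) ∞) (by
      rw [one_add_one_eq_two]
      exact ENat.LEInfty.out)
  have hA := (hm.comp (contMDiff_equivTangentBundleProd_symm (I := 𝓘(ℝ, E)) (M := G)
    (I' := 𝓘(ℝ, E)) (M' := G))).comp (hz.prodMk hv)
  have hA' : ContMDiff (𝓘(ℝ, E).prod 𝓘(ℝ, E)) 𝓘(ℝ, E).tangent 1
      (fun y : G × E => (Bundle.TotalSpace.mk' E y.1 (leftDeriv (E := E) y.1 (ψ y.2)) :
        TangentBundle 𝓘(ℝ, E) G)) := by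
    convert hA using 1
    funext y
    exact tangentBundle_mk_congr (mul_one y.1).symm (mfderiv_mul_inr y.1 (ψ y.2)).symm
  have hB : ContMDiff 𝓘(ℝ, E) 𝓘(ℝ, E).tangent 1
      (fun x : E => (⟨x, f x⟩ : TangentBundle 𝓘(ℝ, E) E)) := by
    rw [← contMDiffOn_univ]
    intro x _
    exact contMDiffWithinAt_vectorSpace_iff_contDiffWithinAt.2 hf.contDiffAt.contDiffWithinAt
  have hAB := (contMDiff_equivTangentBundleProd_symm (I := 𝓘(ℝ, E)) (M := G)
    (I' := 𝓘(ℝ, E)) (M' := E)).comp (hA'.prodMk (hB.comp contMDiff_snd))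
  exact hAB

end Field

/-! ### Existence and uniqueness for g' = g·ψ(x), x' = f(x) -/

section LeftCurves

variable {E : Type*} [NormedAddCommGroup E] [NormedSpace ℝ E]
  {G : Type*} [TopologicalSpace G] [ChartedSpace E G] [Group G]

/-- At time `t` the curve `(g, x)` in `G × E` solves `g' = g · ψ x`, `x' = f x`. -/
def IsLeftCurveAt (ψ f : E → E) (g : ℝ → G) (x : ℝ → E) (t : ℝ) : Prop :=
  HasMFDerivAt 𝓘(ℝ, ℝ) 𝓘(ℝ, E) g t
    (ContinuousLinearMap.smulRight (1 : ℝ →L[ℝ] ℝ) (leftDeriv (E := E) (g t) (ψ (x t)))) ∧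
  HasDerivAt x (f (x t)) t

variable {ψ f : E → E} {g g' : ℝ → G} {x x' : ℝ → E} {t : ℝ}

theorem isLeftCurveAt_iff :
    IsLeftCurveAt ψ f g x t ↔ HasMFDerivAt 𝓘(ℝ, ℝ) (𝓘(ℝ, E).prod 𝓘(ℝ, E))
      (fun s => (g s, x s)) t
      (ContinuousLinearMap.smulRight (1 : ℝ →L[ℝ] ℝ) (leftField ψ f (g t, x t))) := by
  constructor
  · rintro ⟨h1, h2⟩
    have h3 : HasMFDerivAt 𝓘(ℝ, ℝ) 𝓘(ℝ, E) x t
      (ContinuousLinearMap.smulRight (1 : ℝ →L[ℝ] ℝ) (f (x t))) := by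
      refine hasMFDerivAt_iff_hasFDerivAt.2 ?_
      refine h2.hasFDerivAt.congr_fderiv ?_
      ext
      exact (one_smul ℝ (f (x t))).trans (one_smul ℝ (f (x t))).symm
    refine (h1.prodMk h3).congr_mfderiv ?_
    ext
    · rfl
    · rfl
  · intro h
    have h1 := HasMFDerivAt.comp t (hasMFDerivAt_fst (I := 𝓘(ℝ, E)) (I' := 𝓘(ℝ, E))
      (x := (g t, x t))) h
    have h2 := HasMFDerivAt.comp t (hasMFDerivAt_snd (I := 𝓘(ℝ, E)) (I' := 𝓘(ℝ, E))
      (x := (g t, x t))) h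
    refine ⟨h1.congr_mfderiv ?_, ?_⟩
    · ext
      rfl
    · have h3 : HasFDerivAt x (ContinuousLinearMap.smulRight (1 : ℝ →L[ℝ] ℝ) (f (x t))) t :=
        hasMFDerivAt_iff_hasFDerivAt.1 h2
      simpa using h3.hasDerivAt

theorem IsLeftCurveAt.congr_field {ψ' f' : E → E} (h : IsLeftCurveAt ψ f g x t)
    (hψ : ψ (x t) = ψ' (x t)) (hf : f (x t) = f' (x t)) : IsLeftCurveAt ψ' f' g x t := by
  rw [IsLeftCurveAt, ← hψ, ← hf]
  exact h

theorem IsLeftCurveAt.comp_add_const {s : ℝ} (h : IsLeftCurveAt ψ f g x (t + s)) :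
    IsLeftCurveAt ψ f (fun u => g (u + s)) (fun u => x (u + s)) t := by
  refine ⟨?_, h.2.comp_add_const t s⟩
  have h1 : HasMFDerivAt 𝓘(ℝ, ℝ) 𝓘(ℝ, ℝ) (fun u : ℝ => u + s) t (ContinuousLinearMap.id ℝ ℝ) :=
    hasMFDerivAt_iff_hasFDerivAt.2 ((hasFDerivAt_id t).add_const s)
  have h2 := HasMFDerivAt.comp (g := g) (f := fun u : ℝ => u + s) t h.1 h1
  refine h2.congr_mfderiv ?_
  ext
  rfl

variable [LieGroup 𝓘(ℝ, E) ∞ G]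

theorem IsLeftCurveAt.mul_left (h : IsLeftCurveAt ψ f g x t) (g₀ : G) :
    IsLeftCurveAt ψ f (fun s => g₀ * g s) x t := by
  refine ⟨?_, h.2⟩
  have h2 := HasMFDerivAt.comp t (hasMFDerivAt_mul_left (E := E) g₀ (g t)) h.1
  refine h2.congr_mfderiv ?_
  ext
  have := DFunLike.congr_fun (mulLeftDeriv_comp_leftDeriv (E := E) g₀ (g t)) (ψ (x t))
  exact (map_smul (mulLeftDeriv (E := E) g₀ (g t)) (1 : ℝ) _).trans
    (congrArg (fun v : E => (1 : ℝ) • v) this)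

/-- Uniqueness of solutions of `g' = g · ψ x`, `x' = f x`. -/
theorem IsLeftCurveAt.eq_of_eq [CompleteSpace E] [T2Space G] (hψ : ContDiff ℝ 1 ψ)
    (hf : ContDiff ℝ 1 f) {J : Set ℝ} (hJ : IsOpen J) (hJ' : J.OrdConnected)
    (h : ∀ t ∈ J, IsLeftCurveAt ψ f g x t) (h' : ∀ t ∈ J, IsLeftCurveAt ψ f g' x' t)
    {s : ℝ} (hs : s ∈ J) (hg : g s = g' s) (hx : x s = x' s) (ht : t ∈ J) :
    g t = g' t ∧ x t = x' t := by
  -- Openness of J gives room beyond min s t and max s t, and order-connectedness fills the middle.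
  obtain ⟨a, b, hsab, htab, hab⟩ : ∃ a b, s ∈ Set.Ioo a b ∧ t ∈ Set.Ioo a b ∧
      Set.Ioo a b ⊆ J := by
    have hmin : min s t ∈ J := by rcases min_choice s t with h | h <;> rwa [h]
    have hmax : max s t ∈ J := by rcases max_choice s t with h | h <;> rwa [h]
    obtain ⟨a, b', ha, haJ⟩ := (mem_nhds_iff_exists_Ioo_subset).1 (hJ.mem_nhds hmin)
    obtain ⟨a', b, hb, hbJ⟩ := (mem_nhds_iff_exists_Ioo_subset).1 (hJ.mem_nhds hmax)
    refine ⟨a, b, ⟨ha.1.trans_le (min_le_left _ _), (le_max_left _ _).trans_lt hb.2⟩,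
      ⟨ha.1.trans_le (min_le_right _ _), (le_max_right _ _).trans_lt hb.2⟩, ?_⟩
    intro u hu
    rcases le_total u (min s t) with h1 | h1
    · exact haJ ⟨hu.1, h1.trans_lt ha.2⟩
    rcases le_total (max s t) u with h2 | h2
    · exact hbJ ⟨hb.1.trans_le h2, hu.2⟩
    · exact hJ'.out hmin hmax ⟨h1, h2⟩
  have h1 := isMIntegralCurveOn_Ioo_eqOn_of_contMDiff_boundaryless (M := G × E) hsab
    (contMDiff_leftField hψ hf)
    (fun u hu => (isLeftCurveAt_iff.1 (h u (hab hu))).hasMFDerivWithinAt)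
    (fun u hu => (isLeftCurveAt_iff.1 (h' u (hab hu))).hasMFDerivWithinAt)
    (by simp only [hg, hx])
  exact Prod.mk.injEq _ _ _ _ ▸ h1 htab

theorem isLeftCurveAt_chart {q : ℝ → E} (hq : q t ∈ (extChartAt 𝓘(ℝ, E) (1 : G)).target)
    (hd : HasDerivAt (fun s => (q s, x s)) (leftFrame (1 : G) (q t) (ψ (x t)), f (x t)) t) :
    IsLeftCurveAt ψ f (fun s => (extChartAt 𝓘(ℝ, E) (1 : G)).symm (q s)) x t := by
  have hd1 : HasDerivAt q (leftFrame (1 : G) (q t) (ψ (x t))) t := hd.fst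
  refine ⟨?_, hd.snd⟩
  have h1 : HasMFDerivAt 𝓘(ℝ, ℝ) 𝓘(ℝ, E) q t (ContinuousLinearMap.smulRight (1 : ℝ →L[ℝ] ℝ)
      (leftFrame (1 : G) (q t) (ψ (x t)))) := by
    refine hasMFDerivAt_iff_hasFDerivAt.2 (hd1.hasFDerivAt.congr_fderiv ?_)
    ext
    rfl
  have h2 := HasMFDerivAt.comp t (hasMFDerivAt_chart_symm (E := E) hq) h1
  refine h2.congr_mfderiv ?_
  have h3 := chartSymmDeriv_comp_chartDeriv (E := E)
    ((extChartAt 𝓘(ℝ, E) (1 : G)).map_target hq)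
  rw [(extChartAt 𝓘(ℝ, E) (1 : G)).right_inv hq] at h3
  have h4 := DFunLike.congr_fun h3
    (leftDeriv (E := E) ((extChartAt 𝓘(ℝ, E) (1 : G)).symm (q t)) (ψ (x t)))
  ext
  exact (map_smul (chartSymmDeriv (E := E) (1 : G) (q t)) (1 : ℝ) _).trans
    (congrArg (fun v : E => (1 : ℝ) • v) h4)

/-- Picard–Lindelöf in the chart at 1. Starting at g = 1 is enough, since left translation carries
solutions to solutions. -/
theorem exists_leftCurve_near [CompleteSpace E] (hψ : ContDiff ℝ 1 ψ) (hf : ContDiff ℝ 1 f)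
    (x₀ : E) :
    ∃ U ∈ 𝓝 x₀, ∃ ε > (0 : ℝ), ∀ y ∈ U, ∃ (g : ℝ → G) (x : ℝ → E), g 0 = 1 ∧ x 0 = y ∧
      ∀ t ∈ Set.Ioo (-ε) ε, IsLeftCurveAt ψ f g x t := by
  set a := extChartAt 𝓘(ℝ, E) (1 : G) 1 with ha
  let V : E × E → E × E := fun z => (leftFrame (1 : G) z.1 (ψ z.2), f z.2)
  have hV : ContDiffAt ℝ 1 V (a, x₀) := by
    have h1 : ContDiffAt ℝ 1 (fun z : E × E => leftFrame (1 : G) z.1) (a, x₀) :=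
      ContDiffAt.comp (g := leftFrame (1 : G)) (a, x₀)
        ((contDiffAt_leftFrame (E := E) (1 : G)).of_le (by simp)) contDiffAt_fst
    exact (h1.clm_apply (hψ.contDiffAt.comp _ contDiffAt_snd)).prodMk
      (hf.contDiffAt.comp _ contDiffAt_snd)
  obtain ⟨ε, hε, ρ, r, L, K, hr, hpl⟩ := IsPicardLindelof.of_contDiffAt_one hV
  obtain ⟨α, hα, hcont⟩ :=
    (hpl 0).exists_forall_mem_closedBall_eq_hasDerivWithinAt_continuousOn
  have hr' : (0 : ℝ) < r := by exact_mod_cast hr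
  have hnhds : Metric.closedBall (a, x₀) r ×ˢ Set.Icc (0 - ε) (0 + ε) ∈ 𝓝 ((a, x₀), (0 : ℝ)) :=
    prod_mem_nhds (Metric.closedBall_mem_nhds _ hr') (Icc_mem_nhds (by linarith) (by linarith))
  have hcA : ContinuousAt (fun p => (α p).1) ((a, x₀), (0 : ℝ)) :=
    continuousAt_fst.comp (hcont.continuousAt hnhds)
  have hα0 : α ((a, x₀), 0) = (a, x₀) := (hα (a, x₀) (Metric.mem_closedBall_self hr'.le)).1
  have htarget : (extChartAt 𝓘(ℝ, E) (1 : G)).target ∈ 𝓝 ((α ((a, x₀), (0 : ℝ))).1) := by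
    rw [hα0]
    exact extChartAt_target_mem_nhds (I := 𝓘(ℝ, E)) (1 : G)
  -- Joint continuity of the local flow gives one time interval on which all curves with nearby
  -- initial momenta stay in the chart.
  have hmem := Filter.inter_mem (Filter.mem_map.1 (hcA htarget)) hnhds
  rw [nhds_prod_eq, Filter.mem_prod_iff] at hmem
  obtain ⟨U, hU, W, hW, hUW⟩ := hmem
  obtain ⟨δ, hδ, hδW⟩ := Metric.mem_nhds_iff.1 hW
  refine ⟨(fun y => (a, y)) ⁻¹' U, ?_, min δ ε, lt_min hδ hε, ?_⟩
  · have : ContinuousAt (fun y : E => (a, y)) x₀ := by fun_prop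
    exact this hU
  intro y hy
  have hmem0 := hUW (Set.mk_mem_prod hy (mem_of_mem_nhds hW))
  obtain ⟨h0, hd⟩ := hα (a, y) hmem0.2.1
  refine ⟨fun t => (extChartAt 𝓘(ℝ, E) (1 : G)).symm (α ((a, y), t)).1,
    fun t => (α ((a, y), t)).2, ?_, ?_, ?_⟩
  · have h0' : (α ((a, y), 0)).1 = a := congrArg Prod.fst h0
    simp only [h0']
    exact extChartAt_to_inv (I := 𝓘(ℝ, E)) (1 : G)
  · exact congrArg Prod.snd h0
  intro t ht
  have htW : t ∈ W := hδW (by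
    rw [Real.ball_eq_Ioo]
    exact ⟨by linarith [ht.1, min_le_left δ ε], by linarith [ht.2, min_le_left δ ε]⟩)
  have hmemt := hUW (Set.mk_mem_prod hy htW)
  have htI : Set.Icc (0 - ε) (0 + ε) ∈ 𝓝 t :=
    Icc_mem_nhds (by linarith [ht.1, min_le_right δ ε]) (by linarith [ht.2, min_le_right δ ε])
  exact isLeftCurveAt_chart (q := fun t => (α ((a, y), t)).1) hmemt.1
    ((hd t (mem_of_mem_nhds htI)).hasDerivAt htI)

/-- The existence time is uniform: compactness covers the x in the ball, left translation covers all
g, and outside the ball the field vanishes. A uniform time allows indefinite continuation. -/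
theorem exists_leftCurve_of_compact_support [FiniteDimensional ℝ E] [T2Space G]
    (hψ : ContDiff ℝ 1 ψ) (hf : ContDiff ℝ 1 f)
    (R : ℝ) (hR : ∀ x, R < ‖x‖ → ψ x = 0 ∧ f x = 0) (g₀ : G) (x₀ : E) :
    ∃ (g : ℝ → G) (x : ℝ → E), g 0 = g₀ ∧ x 0 = x₀ ∧ ∀ t, IsLeftCurveAt ψ f g x t := by
  have : CompleteSpace E := FiniteDimensional.complete ℝ E
  have hK : ∃ ε > (0 : ℝ), ∀ y ∈ Metric.closedBall (0 : E) R, ∃ (g : ℝ → G) (x : ℝ → E),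
      g 0 = 1 ∧ x 0 = y ∧ ∀ t ∈ Set.Ioo (-ε) ε, IsLeftCurveAt ψ f g x t := by
    refine (isCompact_closedBall (0 : E) R).induction_on
      (p := fun s => ∃ ε > (0 : ℝ), ∀ y ∈ s, ∃ (g : ℝ → G) (x : ℝ → E),
        g 0 = 1 ∧ x 0 = y ∧ ∀ t ∈ Set.Ioo (-ε) ε, IsLeftCurveAt ψ f g x t) ?_ ?_ ?_ ?_
    · exact ⟨1, one_pos, by simp⟩
    · rintro s t hst ⟨ε, hε, h⟩
      exact ⟨ε, hε, fun y hy => h y (hst hy)⟩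
    · rintro s t ⟨ε, hε, h⟩ ⟨ε', hε', h'⟩
      refine ⟨min ε ε', lt_min hε hε', ?_⟩
      rintro y (hy | hy)
      · obtain ⟨g, x, h1, h2, h3⟩ := h y hy
        exact ⟨g, x, h1, h2, fun t ht => h3 t ⟨by linarith [ht.1, min_le_left ε ε'],
          by linarith [ht.2, min_le_left ε ε']⟩⟩
      · obtain ⟨g, x, h1, h2, h3⟩ := h' y hy
        exact ⟨g, x, h1, h2, fun t ht => h3 t ⟨by linarith [ht.1, min_le_right ε ε'],
          by linarith [ht.2, min_le_right ε ε']⟩⟩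
    · intro y _
      obtain ⟨U, hU, ε, hε, h⟩ := exists_leftCurve_near (G := G) hψ hf y
      exact ⟨U, mem_nhdsWithin_of_mem_nhds hU, ε, hε, h⟩
  obtain ⟨ε, hε, hK⟩ := hK
  have huniform : ∀ p : G × E, ∃ γ : ℝ → G × E, γ 0 = p ∧
      IsMIntegralCurveOn (I := 𝓘(ℝ, E).prod 𝓘(ℝ, E)) γ (leftField ψ f) (Set.Ioo (-ε) ε) := by
    rintro ⟨q, y⟩
    obtain ⟨g, x, h1, h2, h3⟩ : ∃ (g : ℝ → G) (x : ℝ → E),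
        g 0 = 1 ∧ x 0 = y ∧ ∀ t ∈ Set.Ioo (-ε) ε, IsLeftCurveAt ψ f g x t := by
      rcases le_or_gt ‖y‖ R with hy | hy
      · exact hK y (by simpa using hy)
      · refine ⟨fun _ => 1, fun _ => y, rfl, rfl, fun t _ => ⟨?_, ?_⟩⟩
        · rw [(hR y hy).1, map_zero]
          refine (hasMFDerivAt_const (I := 𝓘(ℝ, ℝ)) (I' := 𝓘(ℝ, E)) (1 : G) t).congr_mfderiv ?_
          ext
          exact (smul_zero (1 : ℝ)).symm
        · rw [(hR y hy).2]
          exact hasDerivAt_const t y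
    refine ⟨fun t => (q * g t, x t), by simp [h1, h2], fun t ht => ?_⟩
    exact (isLeftCurveAt_iff.1 ((h3 t ht).mul_left q)).hasMFDerivWithinAt
  obtain ⟨γ, h0, hγ⟩ := exists_isMIntegralCurve_of_isMIntegralCurveOn
    (contMDiff_leftField hψ hf) hε huniform (g₀, x₀)
  exact ⟨fun t => (γ t).1, fun t => (γ t).2, congrArg Prod.fst h0, congrArg Prod.snd h0,
    fun t => isLeftCurveAt_iff.2 (hγ t)⟩

end LeftCurves

/-! ### Global existence from a conserved scalar product -/

section Euler

variable {E : Type*} [NormedAddCommGroup E] [NormedSpace ℝ E] [FiniteDimensional ℝ E]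

theorem exists_norm_le_of_form_le (b : E →L[ℝ] E →L[ℝ] ℝ) (hpos : ∀ v, v ≠ 0 → 0 < b v v) (c : ℝ) :
    ∃ R : ℝ, ∀ x, b x x ≤ c → ‖x‖ ≤ R := by
  obtain ⟨m, hm, hle⟩ : ∃ m > (0 : ℝ), ∀ u ∈ Metric.sphere (0 : E) 1, m ≤ b u u := by
    rcases (Metric.sphere (0 : E) 1).eq_empty_or_nonempty with h | h
    · exact ⟨1, one_pos, by simp [h]⟩
    · obtain ⟨u, hu, hmin⟩ := (isCompact_sphere (0 : E) 1).exists_isMinOn h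
        (f := fun u => b u u) (by fun_prop)
      refine ⟨b u u, hpos u ?_, fun v hv => hmin hv⟩
      rintro rfl
      simp at hu
  -- From m‖x‖² ≤ c; the bound ‖x‖ ≤ 1 + ‖x‖² avoids a square root.
  refine ⟨1 + c / m, fun x hx => ?_⟩
  rcases eq_or_ne x 0 with rfl | hx0
  · have : 0 ≤ c := by simpa using hx
    rw [norm_zero]
    positivity
  have hn : 0 < ‖x‖ := norm_pos_iff.2 hx0
  have h1 := hle (‖x‖⁻¹ • x) (by simp [norm_smul, hn.ne'])
  have h2 : b (‖x‖⁻¹ • x) (‖x‖⁻¹ • x) = ‖x‖⁻¹ ^ 2 * b x x := by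
    simp
    ring
  have h3 : m * ‖x‖ ^ 2 ≤ c := by
    rw [h2] at h1
    calc m * ‖x‖ ^ 2 ≤ (‖x‖⁻¹ ^ 2 * b x x) * ‖x‖ ^ 2 := by gcongr
      _ = b x x := by field_simp
      _ ≤ c := hx
  have h4 : ‖x‖ ^ 2 ≤ c / m := by
    rw [le_div_iff₀ hm]
    linarith
  nlinarith [sq_nonneg (‖x‖ - 1)]

variable {G : Type*} [TopologicalSpace G] [ChartedSpace E G] [Group G] [LieGroup 𝓘(ℝ, E) ∞ G]

/-- Global existence for `g' = g · ψ x`, `x' = N x`, on the range of a projection that contains the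
values of `N`, when `N` is tangent to the level sets of a scalar product. -/
theorem exists_leftCurve_of_form_conserved [T2Space G] (b : E →L[ℝ] E →L[ℝ] ℝ)
    (hsymm : ∀ v w, b v w = b w v) (hpos : ∀ v, v ≠ 0 → 0 < b v v) {ψ N : E → E}
    (hψ : ContDiff ℝ 1 ψ) (hN : ContDiff ℝ 1 N) (P : E →L[ℝ] E) (hPN : ∀ x, P (N x) = N x)
    (hbN : ∀ x, P x = x → b x (N x) = 0) (g₀ : G) (x₀ : E) (hx₀ : P x₀ = x₀) :
    ∃ (g : ℝ → G) (x : ℝ → E), g 0 = g₀ ∧ x 0 = x₀ ∧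
      ∀ t, P (x t) = x t ∧ IsLeftCurveAt ψ N g x t := by
  obtain ⟨R, hR⟩ := exists_norm_le_of_form_le b hpos (b x₀ x₀)
  -- The maximum with 1 only keeps the inner radius positive. Multiplying both fields by χ preserves
  -- the range of P and the level sets of the form there, so the curve stays where χ = 1 and solves
  -- the original equation.
  let χ : ContDiffBump (0 : E) := ⟨max R 1, max R 1 + 1, by positivity, by linarith⟩
  have hχ : ContDiff ℝ 1 χ := χ.contDiff
  obtain ⟨g, x, hg0, hx0, hgx⟩ := exists_leftCurve_of_compact_support (G := G)
    (hχ.smul hψ) (hχ.smul hN) (max R 1 + 1) (fun y hy => by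
      have : χ y = 0 := χ.zero_of_le_dist (by simpa using hy.le)
      simp [this]) g₀ x₀
  have hP : ∀ t, P (x t) = x t := by
    have hd : ∀ t, HasDerivAt (fun s => P (x s) - x s) 0 t := by
      intro t
      have h := (P.hasFDerivAt.comp_hasDerivAt t (hgx t).2).sub (hgx t).2
      refine h.congr_deriv ?_
      simp [hPN]
    intro t
    have h := is_const_of_deriv_eq_zero (fun t => (hd t).differentiableAt)
      (fun t => (hd t).deriv) t 0
    rw [hx0, hx₀, sub_self] at h
    exact sub_eq_zero.1 h
  have hb : ∀ t, b (x t) (x t) = b x₀ x₀ := by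
    have hd : ∀ t, HasDerivAt (fun s => b (x s) (x s)) 0 t := by
      intro t
      have h := (b.hasFDerivAt.comp_hasDerivAt t (hgx t).2).clm_apply (hgx t).2
      refine h.congr_deriv ?_
      have h0 := hbN (x t) (hP t)
      have h0' : b (N (x t)) (x t) = 0 := by rw [hsymm, h0]
      simp [h0, h0']
    intro t
    have h := is_const_of_deriv_eq_zero (fun t => (hd t).differentiableAt)
      (fun t => (hd t).deriv) t 0
    rw [hx0] at h
    exact h
  refine ⟨g, x, hg0, hx0, fun t => ⟨hP t, (hgx t).congr_field ?_ ?_⟩⟩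
  all_goals
    have : χ (x t) = 1 := χ.one_of_mem_closedBall (mem_closedBall_zero_iff.2
      ((hR (x t) (hb t).le).trans (le_max_left R 1)))
    simp [this]

end Euler

/-- The inclusion I⁻¹ D ⊆ D is an equality, by dimension. -/
theorem apply_mem_of_symm_apply_mem {E : Type*} [NormedAddCommGroup E] [NormedSpace ℝ E]
    [FiniteDimensional ℝ E] (I : E ≃L[ℝ] E) (D : Submodule ℝ E) (hD : ∀ ξ ∈ D, I.symm ξ ∈ D) :
    ∀ ξ ∈ D, I ξ ∈ D := by
  have hle : D.map (I.symm.toLinearEquiv : E →ₗ[ℝ] E) ≤ D := by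
    rintro _ ⟨ξ, hξ, rfl⟩
    exact hD ξ hξ
  have heq := Submodule.eq_of_le_of_finrank_eq hle (LinearEquiv.finrank_map_eq _ D)
  intro ξ hξ
  rw [← heq] at hξ
  obtain ⟨η, hη, rfl⟩ := hξ
  have : I (I.symm η) = η := I.apply_symm_apply η
  exact this.symm ▸ hη

/-! ### The orthogonal projection to D -/

section Projection

variable {E : Type*} [NormedAddCommGroup E] [NormedSpace ℝ E] [FiniteDimensional ℝ E]
  {G : Type*} [TopologicalSpace G] [ChartedSpace E G] [Group G]
  (B : AdInvariantScalarProduct E G) (D : Submodule ℝ (GroupLieAlgebra 𝓘(ℝ, E) G))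

namespace AdInvariantScalarProduct

/-- The orthogonal projection to `D`, as an endomorphism of the model space. -/
def projCLM : E →L[ℝ] E :=
  LinearMap.toContinuousLinearMap (B.proj D : E →ₗ[ℝ] E)

theorem projCLM_mem (x : E) : B.projCLM D x ∈ D :=
  Submodule.projection_apply_mem (B.isCompl_orthogonal D) x

theorem projCLM_eq_self_iff (x : E) : B.projCLM D x = x ↔ x ∈ D :=
  Submodule.projection_eq_self_iff (B.isCompl_orthogonal D) x

theorem formCLM_projCLM {u : E} (hu : u ∈ D) (x : E) :
    B.formCLM u (B.projCLM D x) = B.formCLM u x := by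
  have h : x - B.projCLM D x ∈ B.orthogonal D := by
    have h1 := Submodule.projection_add_projection_eq_self (B.isCompl_orthogonal D) x
    have h2 : x - B.projCLM D x = (B.orthogonal D).projection D (B.isCompl_orthogonal D).symm x :=
      sub_eq_of_eq_add' h1.symm
    rw [h2]
    exact Submodule.projection_apply_mem (B.isCompl_orthogonal D).symm x
  have h3 : B.formCLM u (x - B.projCLM D x) = 0 := h u hu
  rw [map_sub] at h3
  linarith

end AdInvariantScalarProduct

end Projection

/-! ### The metric, the constraint and the Hamiltonians in the left trivialization -/

section Static

variable {E : Type*} [NormedAddCommGroup E] [NormedSpace ℝ E]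
  {G : Type*} [TopologicalSpace G] [ChartedSpace E G] [Group G] [LieGroup 𝓘(ℝ, E) ∞ G]
  (B : AdInvariantScalarProduct E G) (I : E ≃L[ℝ] E) (D : Submodule ℝ (GroupLieAlgebra 𝓘(ℝ, E) G))

namespace AdInvariantScalarProduct

/-- The left-invariant metric, as a bilinear form on the model space. -/
def metricCLM (g : G) : E →L[ℝ] E →L[ℝ] ℝ := B.leftInvariantMetric (I : E →L[ℝ] E) g

theorem metricCLM_leftDeriv (g : G) (v w : E) :
    B.metricCLM I g (leftDeriv g v) (leftDeriv g w) = B.formCLM (I v) w := by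
  have h : ∀ u, (leftDeriv (E := E) g).inverse (leftDeriv g u) = u := by
    intro u
    have h1 : (leftDeriv (E := E) g).inverse = (leftDerivEquiv (E := E) g).symm :=
      ContinuousLinearMap.inverse_equiv (leftDerivEquiv (E := E) g)
    rw [h1]
    exact (leftDerivEquiv (E := E) g).symm_apply_apply u
  change B.formCLM (I ((leftDeriv (E := E) g).inverse (leftDeriv g v)))
    ((leftDeriv (E := E) g).inverse (leftDeriv g w)) = _
  rw [h, h]

variable [FiniteDimensional ℝ E]

/-- The Legendre transform of the metric in the left trivialization; the constraint and both
Hamiltonians are computed from it or from the same evaluation of the metric on translated vectors.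
-/
theorem eq_metricCLM_iff (x : PhaseSpace E G) (u : E) :
    (x.2 : E →L[ℝ] ℝ) = B.metricCLM I x.1 (leftDeriv x.1 u) ↔ B.momentum x = I u := by
  rw [← B.formEquiv.injective.eq_iff]
  constructor
  · intro h
    ext w
    rw [B.formEquiv_momentum, B.formEquiv_apply, ← B.metricCLM_leftDeriv I x.1]
    exact DFunLike.congr_fun h _
  · intro h
    ext v
    obtain ⟨w, rfl⟩ := (leftDerivEquiv (E := E) x.1).surjective v
    refine (B.formEquiv_momentum x w).symm.trans ?_
    rw [h]
    exact (B.metricCLM_leftDeriv I x.1 u w).symm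

theorem metricCLM_inverse (x : PhaseSpace E G) :
    (B.metricCLM I x.1).inverse (x.2 : E →L[ℝ] ℝ) = leftDeriv x.1 (I.symm (B.momentum x)) := by
  have hinj : Function.Injective (B.metricCLM I x.1) := by
    refine (injective_iff_map_eq_zero _).2 fun v hv => ?_
    obtain ⟨w, rfl⟩ := (leftDerivEquiv (E := E) x.1).surjective v
    have h0 : B.formEquiv (I w) = 0 := by
      ext u
      rw [B.formEquiv_apply, ← B.metricCLM_leftDeriv I x.1, ← leftDerivEquiv_apply x.1 w, hv]
      rfl
    simpa using h0
  -- `ContinuousLinearMap.inverse` is zero on non-invertible maps, so the metric must first be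
  -- recognized as an isomorphism: it is injective between spaces of equal dimension.
  let e : E ≃L[ℝ] (E →L[ℝ] ℝ) := (LinearEquiv.ofInjectiveOfFinrankEq
    (B.metricCLM I x.1).toLinearMap hinj (by
      rw [← (LinearMap.toContinuousLinearMap : (E →ₗ[ℝ] ℝ) ≃ₗ[ℝ] _).finrank_eq]
      exact (Subspace.dual_finrank_eq (K := ℝ) (V := E)).symm)).toContinuousLinearEquiv
  have he : B.metricCLM I x.1 = e := rfl
  have h := (B.eq_metricCLM_iff I x (I.symm (B.momentum x))).2 (by simp)
  rw [h, he, ContinuousLinearMap.inverse_equiv]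
  exact e.symm_apply_apply _

theorem constraintSubmanifold_eq (hD : ∀ ξ ∈ D, I.symm ξ ∈ D) :
    constraintSubmanifold (B.leftInvariantMetric (I : E →L[ℝ] E)) (leftInvariantDistribution D) =
      {x : PhaseSpace E G | B.toLieAlgebra x ∈ D} := by
  have hD' : ∀ ξ : E, ξ ∈ D → I ξ ∈ D := apply_mem_of_symm_apply_mem I (D : Submodule ℝ E) hD
  ext x
  constructor
  · rintro ⟨v, ⟨u, hu, rfl⟩, hv⟩
    have h := (B.eq_metricCLM_iff I x u).1 hv
    change B.momentum x ∈ D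
    rw [h]
    exact hD' u hu
  · intro hx
    refine ⟨leftDeriv (E := E) x.1 (I.symm (B.momentum x)), ⟨_, hD _ hx, rfl⟩, ?_⟩
    exact (B.eq_metricCLM_iff I x (I.symm (B.momentum x))).2 (by simp)

theorem leftExtend_eq_geodesicHamiltonian :
    B.leftExtend (B.reducedHamiltonian (I.symm : E →L[ℝ] E)) =
      geodesicHamiltonian (B.leftInvariantMetric (I : E →L[ℝ] E)) := by
  ext x
  have h1 := B.metricCLM_inverse I x
  have h2 := B.formEquiv_momentum x (I.symm (B.momentum x))
  refine (congrArg (fun r : ℝ => 1 / 2 * r) (h2.trans ?_))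
  exact congrArg x.2 h1.symm

/-- Completing the square: for u ∈ D the quantity to maximize is ½⟨x, u₀⟩ - ½⟨I(u - u₀), u - u₀⟩
with u₀ = A x_D. Since u₀ ∈ D, the supremum is attained there. -/
theorem leftExtend_eq_subRiemannianHamiltonian
    (hI_symm : ∀ v w, B.formCLM (I v) w = B.formCLM v (I w))
    (hI_pos : ∀ v, v ≠ 0 → 0 < B.formCLM (I v) v) (hD : ∀ ξ ∈ D, I.symm ξ ∈ D) :
    B.leftExtend (B.reducedHamiltonianStar (I.symm : E →L[ℝ] E) D) =
      subRiemannianHamiltonian (B.leftInvariantMetric (I : E →L[ℝ] E))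
        (leftInvariantDistribution D) := by
  ext x
  have hu₀ : I.symm (B.projCLM D (B.momentum x)) ∈ D := hD _ (B.projCLM_mem D _)
  set u₀ : E := I.symm (B.projCLM D (B.momentum x)) with hu₀def
  have hval : ∀ u : E, x.2 (leftDeriv (E := E) x.1 u) -
      (1 / 2) * B.metricCLM I x.1 (leftDeriv x.1 u) (leftDeriv x.1 u) =
      B.formCLM (B.momentum x) u - (1 / 2) * B.formCLM (I u) u := by
    intro u
    rw [B.metricCLM_leftDeriv, ← B.formEquiv_apply (B.momentum x), B.formEquiv_momentum]
  have hproj : ∀ u : E, u ∈ D → B.formCLM (I u₀) u = B.formCLM (B.momentum x) u := by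
    intro u hu
    rw [hu₀def, I.apply_symm_apply, B.formCLM_symm, B.formCLM_projCLM D hu, B.formCLM_symm]
  have hle : ∀ u : E, u ∈ D → B.formCLM (B.momentum x) u - (1 / 2) * B.formCLM (I u) u ≤
      (1 / 2) * B.formCLM (B.momentum x) u₀ := by
    intro u hu
    have h0 : 0 ≤ B.formCLM (I (u - u₀)) (u - u₀) := by
      rcases eq_or_ne (u - u₀) 0 with h | h
      · simp [h]
      · exact (hI_pos _ h).le
    have h1 := hproj u hu
    have h2 := hproj u₀ hu₀
    have h3 : B.formCLM (I u) u₀ = B.formCLM (I u₀) u := by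
      rw [hI_symm, B.formCLM_symm]
    simp only [map_sub, sub_apply] at h0
    linarith
  have hmax : IsGreatest (Set.range fun v : leftInvariantDistribution D x.1 =>
      x.2 (v : TangentSpace 𝓘(ℝ, E) x.1) -
        (1 / 2) * B.leftInvariantMetric (I : E →L[ℝ] E) x.1 v v)
      ((1 / 2) * B.formCLM (B.momentum x) u₀) := by
    constructor
    · refine ⟨⟨leftDeriv (E := E) x.1 u₀, ⟨u₀, hu₀, rfl⟩⟩, ?_⟩
      refine (hval u₀).trans ?_
      rw [hproj u₀ hu₀]
      ring
    · rintro _ ⟨⟨_, ⟨u, hu, rfl⟩⟩, rfl⟩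
      exact (hval u).trans_le (hle u hu)
  exact hmax.isLUB.csSup_eq ⟨_, hmax.1⟩ |>.symm

end AdInvariantScalarProduct

end Static

/-! ### Projection, orthogonality and the operator A -/

section Reduction

variable {E : Type*} [NormedAddCommGroup E] [NormedSpace ℝ E] [FiniteDimensional ℝ E]
  {G : Type*} [TopologicalSpace G] [ChartedSpace E G] [Group G]

namespace AdInvariantScalarProduct

variable (B : AdInvariantScalarProduct E G) (D : Submodule ℝ (GroupLieAlgebra 𝓘(ℝ, E) G))

theorem formCLM_projCLM_left (x y : E) :
    B.formCLM (B.projCLM D x) y = B.formCLM x (B.projCLM D y) := by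
  rw [← B.formCLM_projCLM D (B.projCLM_mem D x) y, B.formCLM_symm,
    B.formCLM_projCLM D (B.projCLM_mem D y) x, B.formCLM_symm]

theorem sub_projCLM_mem (x : E) : x - B.projCLM D x ∈ B.orthogonal D :=
  Submodule.sub_projection_mem (B.isCompl_orthogonal D) x

theorem projCLM_comm (A : E →L[ℝ] E) (hA_D : ∀ ξ : E, ξ ∈ D → A ξ ∈ D)
    (hA_L : ∀ η : E, η ∈ B.orthogonal D → A η ∈ B.orthogonal D) (x : E) :
    B.projCLM D (A x) = A (B.projCLM D x) := by
  have h1 : A x = A (B.projCLM D x) + A (x - B.projCLM D x) := by rw [← map_add]; simp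
  have h2 : B.projCLM D (A (x - B.projCLM D x)) = 0 :=
    (Submodule.projection_apply_eq_zero_iff (B.isCompl_orthogonal D)).2
      (hA_L _ (B.sub_projCLM_mem D x))
  rw [h1, map_add, h2, add_zero]
  exact (B.projCLM_eq_self_iff D _).2 (hA_D _ (B.projCLM_mem D x))

/-- The component of x in the complement, paired with x, gives its own square norm, which therefore
vanishes. -/
theorem mem_of_orthogonal_orthogonal {x : E}
    (hx : ∀ η : E, η ∈ B.orthogonal D → B.formCLM η x = 0) : x ∈ D := by
  rw [← B.projCLM_eq_self_iff D]
  by_contra hne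
  have h0 : x - B.projCLM D x ≠ 0 := fun h => hne (sub_eq_zero.1 h).symm
  have h1 : 0 < B.formCLM (x - B.projCLM D x) (x - B.projCLM D x) := B.pos _ h0
  have h2 := hx _ (B.sub_projCLM_mem D x)
  have h3 : B.formCLM (B.projCLM D x) (x - B.projCLM D x) = 0 :=
    B.sub_projCLM_mem D x _ (B.projCLM_mem D x)
  rw [B.formCLM_symm] at h3
  rw [map_sub, h2, h3] at h1
  simp at h1

end AdInvariantScalarProduct

end Reduction

/-! ### Invariance under the subgroup, infinitesimally -/

section Subgroup

variable {E : Type*} [NormedAddCommGroup E] [NormedSpace ℝ E]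
  {G : Type*} [TopologicalSpace G] [ChartedSpace E G] [Group G] [LieGroup 𝓘(ℝ, E) ∞ G]
  {E' : Type*} [NormedAddCommGroup E'] [NormedSpace ℝ E']
  {K : Type*} [TopologicalSpace K] [ChartedSpace E' K] [Group K] [LieGroup 𝓘(ℝ, E') ∞ K]

/-- The differential at the identity of a homomorphism, on the model spaces. -/
def homDeriv (E : Type*) [NormedAddCommGroup E] [NormedSpace ℝ E]
    {G : Type*} [TopologicalSpace G] [ChartedSpace E G] [Group G]
    (E' : Type*) [NormedAddCommGroup E'] [NormedSpace ℝ E']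
    {K : Type*} [TopologicalSpace K] [ChartedSpace E' K] [Group K] (ι : K →* G) : E' →L[ℝ] E :=
  mfderiv 𝓘(ℝ, E') 𝓘(ℝ, E) ι 1

theorem hasFDerivAt_hom_chart {ι : K →* G} (hι : ContMDiff 𝓘(ℝ, E') 𝓘(ℝ, E) ∞ ι) :
    HasFDerivAt (fun y => extChartAt 𝓘(ℝ, E) (1 : G) (ι ((extChartAt 𝓘(ℝ, E') (1 : K)).symm y)))
      (homDeriv E E' ι) (extChartAt 𝓘(ℝ, E') (1 : K) 1) := by
  refine hasMFDerivAt_iff_hasFDerivAt.1 ?_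
  have h1 := hasMFDerivAt_chart_symm (mem_extChartAt_target (I := 𝓘(ℝ, E')) (1 : K))
  rw [chartSymmDeriv_self] at h1
  have h2 : HasMFDerivAt 𝓘(ℝ, E') 𝓘(ℝ, E) ι
      ((extChartAt 𝓘(ℝ, E') (1 : K)).symm (extChartAt 𝓘(ℝ, E') (1 : K) 1))
      (homDeriv E E' ι) := by
    rw [extChartAt_to_inv]
    exact ((hι.mdifferentiable (by simp)) 1).hasMFDerivAt
  have h3 : HasMFDerivAt 𝓘(ℝ, E) 𝓘(ℝ, E) (extChartAt 𝓘(ℝ, E) (1 : G))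
      (ι ((extChartAt 𝓘(ℝ, E') (1 : K)).symm (extChartAt 𝓘(ℝ, E') (1 : K) 1)))
      (ContinuousLinearMap.id ℝ E) := by
    rw [extChartAt_to_inv, map_one]
    have := hasMFDerivAt_chart (mem_extChartAt_source (I := 𝓘(ℝ, E)) (1 : G))
    rwa [chartDeriv_self] at this
  have h4 := h2.comp (extChartAt 𝓘(ℝ, E') (1 : K) 1) h1
  exact HasMFDerivAt.comp (extChartAt 𝓘(ℝ, E') (1 : K) 1) (f := fun y =>
    ι ((extChartAt 𝓘(ℝ, E') (1 : K)).symm y)) h3 h4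

variable [FiniteDimensional ℝ E]

theorem hasFDerivAt_adDeriv_hom {ι : K →* G} (hι : ContMDiff 𝓘(ℝ, E') 𝓘(ℝ, E) ∞ ι) :
    HasFDerivAt (fun y => adDeriv (E := E) (ι ((extChartAt 𝓘(ℝ, E') (1 : K)).symm y)))
      ((bracketCLM E G).comp (homDeriv E E' ι)) (extChartAt 𝓘(ℝ, E') (1 : K) 1) := by
  have : CompleteSpace E := FiniteDimensional.complete ℝ E
  have h1 := hasFDerivAt_adDeriv_chart (E := E) (G := G)
  have h0 : extChartAt 𝓘(ℝ, E) (1 : G)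
      (ι ((extChartAt 𝓘(ℝ, E') (1 : K)).symm (extChartAt 𝓘(ℝ, E') (1 : K) 1))) =
      extChartAt 𝓘(ℝ, E) (1 : G) 1 := by
    rw [extChartAt_to_inv, map_one]
  rw [← h0] at h1
  have h2 := HasFDerivAt.comp
    (g := fun z => adDeriv (E := E) ((extChartAt 𝓘(ℝ, E) (1 : G)).symm z))
    (extChartAt 𝓘(ℝ, E') (1 : K) 1) h1
    (hasFDerivAt_hom_chart (E := E) (E' := E') hι)
  refine h2.congr_of_eventuallyEq ?_
  have hcont : ContinuousAt (fun y => ι ((extChartAt 𝓘(ℝ, E') (1 : K)).symm y))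
      (extChartAt 𝓘(ℝ, E') (1 : K) 1) :=
    ContinuousAt.comp (g := ι) hι.continuous.continuousAt
      (continuousAt_extChartAt_symm (I := 𝓘(ℝ, E')) (1 : K))
  have hsrc : (extChartAt 𝓘(ℝ, E) (1 : G)).source ∈
      𝓝 (ι ((extChartAt 𝓘(ℝ, E') (1 : K)).symm (extChartAt 𝓘(ℝ, E') (1 : K) 1))) := by
    rw [extChartAt_to_inv, map_one]
    exact extChartAt_source_mem_nhds _
  filter_upwards [hcont hsrc] with y hy
  simp only [Function.comp_apply]
  rw [(extChartAt 𝓘(ℝ, E) (1 : G)).left_inv hy]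

/-- If the reduced Hamiltonian is invariant on `D` under the adjoint action of a subgroup with Lie
algebra `D^⊥`, then `[ξ, A ξ] ∈ D` for all `ξ ∈ D`. -/
theorem bracket_mem_of_invariant (B : AdInvariantScalarProduct E G)
    (D : Submodule ℝ (GroupLieAlgebra 𝓘(ℝ, E) G)) (A : E →L[ℝ] E)
    (hA : ∀ v w, B.formCLM v (A w) = B.formCLM (A v) w)
    {ι : K →* G} (hι : ContMDiff 𝓘(ℝ, E') 𝓘(ℝ, E) ∞ ι)
    (hL : ∀ η : E, η ∈ B.orthogonal D → ∃ y, homDeriv E E' ι y = η)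
    (hInv : ∀ k : K, ∀ ξ : E, ξ ∈ D → B.formCLM (adDeriv (ι k) ξ) (A (adDeriv (ι k) ξ)) =
      B.formCLM ξ (A ξ)) (ξ : E) (hξ : ξ ∈ D) : bracketCLM E G ξ (A ξ) ∈ D := by
  refine B.mem_of_orthogonal_orthogonal D fun η hη => ?_
  obtain ⟨y, rfl⟩ := hL η hη
  -- With η the image of y, differentiate the constant ⟨Ad ξ, A Ad ξ⟩ along the subgroup. The two
  -- product-rule terms agree by symmetry of A, so ⟨[η, ξ], A ξ⟩ = 0, and associativity of the form
  -- moves the bracket to [ξ, A ξ].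
  have h1 := (hasFDerivAt_adDeriv_hom (E := E) (E' := E') hι).clm_apply (hasFDerivAt_const ξ _)
  have h2 := (B.formCLM.hasFDerivAt.comp _ h1).clm_apply (A.hasFDerivAt.comp _ h1)
  have h3 := h2.congr_of_eventuallyEq (f₁ := fun _ => B.formCLM ξ (A ξ))
    (Filter.Eventually.of_forall fun y => (hInv _ ξ hξ).symm)
  have h4 := DFunLike.congr_fun (h3.unique (hasFDerivAt_const _ _)) y
  have h5 : B.formCLM ξ (A (bracketCLM E G (homDeriv E E' ι y) ξ)) =
      B.formCLM (bracketCLM E G (homDeriv E E' ι y) ξ) (A ξ) := by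
    rw [hA, B.formCLM_symm]
  rw [← B.formCLM_bracket_assoc]
  simp [adDeriv_one, h5] at h4
  exact h4

end Subgroup

/-! ### Solutions in momentum form and their uniqueness -/

section Flow

variable {E : Type*} [NormedAddCommGroup E] [NormedSpace ℝ E]
  {G : Type*} [TopologicalSpace G] [ChartedSpace E G] [Group G]

variable (G) in
theorem contDiff_euler (S : E →L[ℝ] E) : ContDiff ℝ 1 (fun x => bracketCLM E G x (S x)) := by
  fun_prop

variable [FiniteDimensional ℝ E] [LieGroup 𝓘(ℝ, E) ∞ G] (B : AdInvariantScalarProduct E G)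

namespace AdInvariantScalarProduct

/-- The covector at `g` with left-trivialized momentum `x`. -/
def ofMomentum (g : G) (x : E) : PhaseSpace E G :=
  ⟨g, (B.formEquiv x).comp ((leftDerivEquiv (E := E) g).symm : E →L[ℝ] E)⟩

theorem momentum_ofMomentum (g : G) (x : E) : B.momentum (B.ofMomentum g x) = x := by
  rw [momentum_eq, ContinuousLinearEquiv.symm_apply_eq]
  ext w
  exact congrArg (B.formEquiv x) ((leftDerivEquiv (E := E) g).symm_apply_apply w)

theorem ext_momentum {x y : PhaseSpace E G} (h1 : x.1 = y.1) (h2 : B.momentum x = B.momentum y) :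
    x = y := by
  obtain ⟨g, p⟩ := x
  obtain ⟨g', p'⟩ := y
  obtain rfl : g = g' := h1
  have h : (p : E →L[ℝ] ℝ) = p' := by
    ext v
    obtain ⟨w, rfl⟩ := (leftDerivEquiv (E := E) g).surjective v
    have h3 := B.formEquiv_momentum ⟨g, p⟩ w
    have h4 := B.formEquiv_momentum ⟨g, p'⟩ w
    rw [h2] at h3
    exact h3.symm.trans h4
  exact congrArg (Bundle.TotalSpace.mk g) h

/-- The left trivialization of the curve `γ` solves `g' = g · S x`, `x' = [x, S x]` at time `t`. -/
def IsEulerCurveAt (S : E →L[ℝ] E) (γ : ℝ → PhaseSpace E G) (t : ℝ) : Prop :=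
  IsLeftCurveAt S (fun x => bracketCLM E G x (S x)) (fun s => (γ s).1) (fun s => B.momentum (γ s)) t

theorem isHamiltonianTrajectory_iff (S : E →L[ℝ] E)
    (hS : ∀ v w, B.formCLM v (S w) = B.formCLM (S v) w) (J : Set ℝ) (γ : ℝ → PhaseSpace E G) :
    IsHamiltonianTrajectory (B.leftExtend (B.reducedHamiltonian S)) J γ ↔
      ∀ t ∈ J, B.IsEulerCurveAt S γ t := by
  refine forall₂_congr fun t _ => ?_
  refine (obeysHamiltonEqAt_iff B S hS γ t 0).trans ?_
  rw [ContinuousLinearMap.zero_comp, map_zero, add_zero]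
  exact Iff.rfl

theorem eulerCurve_unique [T2Space G] {S : E →L[ℝ] E} {J : Set ℝ} (hJ : IsOpen J)
    (hJ' : J.OrdConnected) {γ δ : ℝ → PhaseSpace E G} (hγ : ∀ t ∈ J, B.IsEulerCurveAt S γ t)
    (hδ : ∀ t, B.IsEulerCurveAt S δ t) {s : ℝ} (hs : s ∈ J) (h : γ s = δ 0) {t : ℝ} (ht : t ∈ J) :
    γ t = δ (t - s) := by
  have : CompleteSpace E := FiniteDimensional.complete ℝ E
  have hδ' : ∀ t ∈ J, B.IsEulerCurveAt S (fun u => δ (u + -s)) t :=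
    fun t _ => IsLeftCurveAt.comp_add_const (hδ (t + -s))
  have h1 := IsLeftCurveAt.eq_of_eq S.contDiff (contDiff_euler G S) hJ hJ' hγ hδ' hs
    (by simp [h]) (by simp [h]) ht
  exact B.ext_momentum h1.1 h1.2

end AdInvariantScalarProduct

end Flow

/-! ### Coincidence of the three flows -/

section Coincidence

variable {E : Type*} [NormedAddCommGroup E] [NormedSpace ℝ E] [FiniteDimensional ℝ E]
  {G : Type*} [TopologicalSpace G] [ChartedSpace E G] [Group G] [LieGroup 𝓘(ℝ, E) ∞ G]
  (B : AdInvariantScalarProduct E G) (D : Submodule ℝ (GroupLieAlgebra 𝓘(ℝ, E) G))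

namespace AdInvariantScalarProduct

/-- Through every point with momentum in `D` passes a global solution of `g' = g · A x`,
`x' = [x, A x]`, with momentum in `D`. -/
theorem exists_eulerCurve [T2Space G] (A : E →L[ℝ] E)
    (hbr : ∀ ξ : E, ξ ∈ D → bracketCLM E G ξ (A ξ) ∈ D)
    (p : PhaseSpace E G) (hp : B.momentum p ∈ D) :
    ∃ γ : ℝ → PhaseSpace E G, γ 0 = p ∧ ∀ t, B.momentum (γ t) ∈ D ∧ B.IsEulerCurveAt A γ t := by
  let P := B.projCLM D
  -- The hypothesis controls the Euler field only at points of D. Precomposing with P gives a field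
  -- with values in D everywhere that agrees with the Euler field on D.
  let N : E → E := fun x => bracketCLM E G (P x) (A (P x))
  have hN : ContDiff ℝ 1 N := by fun_prop
  have hskew : ∀ x y : E, B.formCLM x (bracketCLM E G x y) = 0 := by
    intro x y
    have hself : bracketCLM E G x x = 0 := by simp [bracketCLM]
    rw [← B.formCLM_bracket_assoc, hself]
    simp
  obtain ⟨g, x, hg, hx, hgx⟩ := exists_leftCurve_of_form_conserved B.formCLM B.formCLM_symm
    (fun v hv => B.pos v hv) A.contDiff hN P
    (fun x => (B.projCLM_eq_self_iff D _).2 (hbr _ (B.projCLM_mem D x)))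
    (fun x hx => by simp only [N, hx, hskew]) p.1 (B.momentum p)
    ((B.projCLM_eq_self_iff D _).2 hp)
  refine ⟨fun t => B.ofMomentum (g t) (x t), ?_, fun t => ?_⟩
  · refine B.ext_momentum ?_ ?_
    · exact hg
    · rw [B.momentum_ofMomentum, hx]
  · obtain ⟨hP, hl⟩ := hgx t
    refine ⟨?_, ?_⟩
    · rw [B.momentum_ofMomentum]
      exact (B.projCLM_eq_self_iff D _).1 hP
    · rw [IsEulerCurveAt]
      simp only [B.momentum_ofMomentum]
      exact hl.congr_field rfl (by simp only [N]; rw [hP])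

theorem isNonholonomicTrajectory_iff (I : E ≃L[ℝ] E)
    (hI : ∀ v w, B.formCLM v (I.symm w) = B.formCLM (I.symm v) w)
    (hD : ∀ ξ ∈ D, I.symm ξ ∈ D)
    (hbr : ∀ ξ : E, ξ ∈ D → bracketCLM E G ξ (I.symm ξ) ∈ D)
    {J : Set ℝ} (hJ : IsOpen J) (γ : ℝ → PhaseSpace E G) :
    IsNonholonomicTrajectory (B.leftInvariantMetric (I : E →L[ℝ] E))
      (leftInvariantDistribution D) J γ ↔
      ∀ t ∈ J, B.momentum (γ t) ∈ D ∧ B.IsEulerCurveAt I.symm γ t := by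
  rw [IsNonholonomicTrajectory, B.constraintSubmanifold_eq I D hD,
    ← B.leftExtend_eq_geodesicHamiltonian I]
  constructor
  · intro h t ht
    obtain ⟨hm, F, hF, hode⟩ := h t ht
    refine ⟨hm, ?_⟩
    obtain ⟨hg, hx⟩ := (obeysHamiltonEqAt_iff B (I.symm : E →L[ℝ] E) hI γ t F).1 hode
    obtain ⟨y, hy, hyF⟩ : ∃ y : E, y = B.formEquiv.symm (ContinuousLinearMap.comp
        (F : E →L[ℝ] ℝ) (leftDeriv (E := E) (γ t).1)) ∧
        ∀ ξ : E, B.formCLM ξ y = F (leftDeriv (E := E) (γ t).1 ξ) :=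
      ⟨_, rfl, fun ξ => (B.formCLM_symm ξ _).trans
        (DFunLike.congr_fun (B.formEquiv.apply_symm_apply _) ξ)⟩
    replace hx : HasDerivAt (fun s => B.momentum (γ s))
        (bracketCLM E G (B.momentum (γ t)) (I.symm (B.momentum (γ t))) + y) t :=
      hx.congr_deriv (congrArg _ hy.symm)
    have hyL : y ∈ B.orthogonal D := fun ξ hξ => (hyF ξ).trans (hF _ ⟨ξ, hξ, rfl⟩)
    -- J is open, so the momentum stays in D for all times near t and its derivative lies in D.
    -- Subtracting [x, A x] ∈ D puts the reaction y in D as well as in L.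
    have hzD : bracketCLM E G (B.momentum (γ t)) (I.symm (B.momentum (γ t))) + y ∈ D := by
      have hP : (fun s => B.projCLM D (B.momentum (γ s))) =ᶠ[𝓝 t] fun s => B.momentum (γ s) := by
        filter_upwards [hJ.mem_nhds ht] with s hs
        exact (B.projCLM_eq_self_iff D _).2 (h s hs).1
      have h3 := (B.projCLM D).hasFDerivAt.comp_hasDerivAt t hx
      rw [← B.projCLM_eq_self_iff D]
      exact h3.unique (hx.congr_of_eventuallyEq hP)
    have hyD : y ∈ D := by
      have := D.sub_mem hzD (hbr _ hm)
      exact (add_sub_cancel_left (bracketCLM E G (B.momentum (γ t))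
        (I.symm (B.momentum (γ t)))) y) ▸ this
    have hy0 : y = 0 := Submodule.disjoint_def.1 (B.isCompl_orthogonal D).disjoint y hyD hyL
    refine ⟨hg, ?_⟩
    rw [hy0, add_zero] at hx
    exact hx
  · intro h t ht
    obtain ⟨hm, he⟩ := h t ht
    refine ⟨hm, 0, fun v _ => rfl, ?_⟩
    exact (B.isHamiltonianTrajectory_iff (I.symm : E →L[ℝ] E) hI J γ).2
      (fun s hs => (h s hs).2) t ht

theorem exists_common_flow [T2Space G] (I : E ≃L[ℝ] E)
    (hI : ∀ v w, B.formCLM v (I.symm w) = B.formCLM (I.symm v) w)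
    (hD : ∀ ξ ∈ D, I.symm ξ ∈ D)
    (hA_L : ∀ η ∈ B.orthogonal D, I.symm η ∈ B.orthogonal D)
    (hbr : ∀ ξ : E, ξ ∈ D → bracketCLM E G ξ (I.symm ξ) ∈ D) (M : Set (PhaseSpace E G))
    (hM : M = {x : PhaseSpace E G | B.toLieAlgebra x ∈ D}) :
    ∃ Φ : ℝ → M → M,
      IsFlowOn (IsNonholonomicTrajectory (B.leftInvariantMetric (I : E →L[ℝ] E))
        (leftInvariantDistribution D)) M Φ ∧
      IsFlowOn (IsHamiltonianTrajectory (B.leftExtend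
        (B.reducedHamiltonian (I.symm : E →L[ℝ] E)))) M Φ ∧
      IsFlowOn (IsHamiltonianTrajectory (B.leftExtend
        (B.reducedHamiltonianStar (I.symm : E →L[ℝ] E) D))) M Φ := by
  have hMD : ∀ x, x ∈ M ↔ B.momentum x ∈ D := fun x => by rw [hM]; rfl
  let A : E →L[ℝ] E := I.symm
  let S : E →L[ℝ] E := A.comp (B.projCLM D)
  have hS : ∀ v w, B.formCLM v (S w) = B.formCLM (S v) w := by
    intro v w
    change B.formCLM v (A (B.projCLM D w)) = B.formCLM (A (B.projCLM D v)) w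
    rw [← B.projCLM_comm D A hD hA_L v, B.formCLM_projCLM_left]
    exact hI _ _
  choose γ hγ0 hγ using fun p : M => B.exists_eulerCurve D A hbr p.1 ((hMD _).1 p.2)
  -- Along a curve with momentum in D the projection has no effect, so orbits of the geodesic flow
  -- also solve the equations of h^*.
  have hγS : ∀ p t, B.IsEulerCurveAt S (γ p) t := by
    intro p t
    have h : B.projCLM D (B.momentum (γ p t)) = B.momentum (γ p t) :=
      (B.projCLM_eq_self_iff D _).2 (hγ p t).1
    have hAS : A (B.momentum (γ p t)) = S (B.momentum (γ p t)) := congrArg A h.symm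
    exact IsLeftCurveAt.congr_field (hγ p t).2 hAS (by simp only [hAS])
  let Φ : ℝ → M → M := fun t p => ⟨γ p t, (hMD _).2 (hγ p t).1⟩
  have huniv : (Set.univ : Set ℝ).OrdConnected := Set.ordConnected_univ
  have hzero : ∀ p, Φ 0 p = p := fun p => Subtype.ext (hγ0 p)
  have hadd : ∀ s t p, Φ (s + t) p = Φ s (Φ t p) := by
    intro s t p
    refine Subtype.ext ?_
    have h := B.eulerCurve_unique (γ := fun u => γ p (u + t)) (δ := γ (Φ t p)) isOpen_univ huniv
      (fun u _ => IsLeftCurveAt.comp_add_const (hγ p (u + t)).2)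
      (fun u => (hγ (Φ t p) u).2) (Set.mem_univ 0) (by simp [hγ0, Φ]) (Set.mem_univ s)
    simpa using h
  -- Used with T = A and T = S. The solution δ need not be known to stay in M: meeting M at one time
  -- s suffices, since the orbit through δ s solves the same equation.
  have huniq : ∀ T : E →L[ℝ] E, (∀ p t, B.IsEulerCurveAt T (γ p) t) → ∀ (J : Set ℝ), IsOpen J →
      J.OrdConnected → ∀ δ : ℝ → PhaseSpace E G, (∀ t ∈ J, B.IsEulerCurveAt T δ t) →
      ∀ s ∈ J, ∀ hs : δ s ∈ M, ∀ t ∈ J, δ t = Φ (t - s) ⟨δ s, hs⟩ := by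
    intro T hT J hJ hJ' δ hδ s hsJ hs t ht
    exact B.eulerCurve_unique hJ hJ' hδ (hT ⟨δ s, hs⟩) hsJ (hγ0 ⟨δ s, hs⟩).symm ht
  refine ⟨Φ, ⟨hzero, hadd, ?_, ?_⟩, ⟨hzero, hadd, ?_, ?_⟩, ⟨hzero, hadd, ?_, ?_⟩⟩
  · intro p
    exact (B.isNonholonomicTrajectory_iff D I hI hD hbr isOpen_univ _).2 (fun t _ => hγ p t)
  · intro J hJ hJ' δ hδ
    exact huniq A (fun p t => (hγ p t).2) J hJ hJ' δ
      (fun t ht => ((B.isNonholonomicTrajectory_iff D I hI hD hbr hJ _).1 hδ t ht).2)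
  · intro p
    exact (B.isHamiltonianTrajectory_iff A hI _ _).2 (fun t _ => (hγ p t).2)
  · intro J hJ hJ' δ hδ
    exact huniq A (fun p t => (hγ p t).2) J hJ hJ' δ
      ((B.isHamiltonianTrajectory_iff A hI _ _).1 hδ)
  · intro p
    exact (B.isHamiltonianTrajectory_iff S hS _ _).2 (fun t _ => hγS p t)
  · intro J hJ hJ' δ hδ
    exact huniq S hγS J hJ hJ' δ ((B.isHamiltonianTrajectory_iff S hS _ _).1 hδ)

end AdInvariantScalarProduct

end Coincidence

end Nonholonomic

end

theorem theorem3
    {E : Type*} [NormedAddCommGroup E] [NormedSpace ℝ E] [FiniteDimensional ℝ E]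
    -- the compact connected Lie group `G`
    {G : Type*} [TopologicalSpace G] [ChartedSpace E G] [Group G] [LieGroup 𝓘(ℝ, E) ∞ G]
    [T2Space G] [CompactSpace G] [ConnectedSpace G]
    -- the `Ad`-invariant scalar product on its Lie algebra
    (B : AdInvariantScalarProduct E G)
    -- the symmetric positive definite operator `I`, with inverse `A = I⁻¹`
    (I : GroupLieAlgebra 𝓘(ℝ, E) G ≃L[ℝ] GroupLieAlgebra 𝓘(ℝ, E) G)
    (hI_symm : ∀ v w, B.form (I v) w = B.form v (I w))
    (hI_pos : ∀ v, v ≠ 0 → 0 < B.form (I v) v)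
    -- the subspace `D`; the operator `A` preserves the orthogonal decomposition `L + D`
    (D : Submodule ℝ (GroupLieAlgebra 𝓘(ℝ, E) G))
    (hA_D : ∀ ξ ∈ D, I.symm ξ ∈ D)
    (hA_L : ∀ η ∈ B.orthogonal D, I.symm η ∈ B.orthogonal D)
    -- the connected Lie subgroup `K` of `G`, whose Lie algebra is `L`
    {E' : Type*} [NormedAddCommGroup E'] [NormedSpace ℝ E'] [FiniteDimensional ℝ E']
    {K : Type*} [TopologicalSpace K] [ChartedSpace E' K] [Group K] [LieGroup 𝓘(ℝ, E') ∞ K]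
    [ConnectedSpace K]
    (ι : K →* G) (hι : IsLieSubgroup (E := E) (E' := E') ι)
    (hL : lieAlgebraOfSubgroup (E := E) (E' := E') ι = B.orthogonal D)
    -- `H_D` is invariant under the adjoint action of `K` on `D`
    (hInv : ∀ k : K, ∀ ξ ∈ D, B.reducedHamiltonian I.symm (adjointAction E (ι k) ξ) =
      B.reducedHamiltonian I.symm ξ)
    -- `D` generates the Lie algebra
    (hGen : LieSubalgebra.lieSpan ℝ (GroupLieAlgebra 𝓘(ℝ, E) G)
      (D : Set (GroupLieAlgebra 𝓘(ℝ, E) G)) = ⊤) :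
    -- the constraint submanifold is the distribution, in the bi-invariant identification
    constraintSubmanifold (B.leftInvariantMetric I) (leftInvariantDistribution D) =
      {x | B.toLieAlgebra x ∈ D} ∧
    -- `h` is the Hamiltonian of the left-invariant metric, and
    -- `h^*` is the normal Hamiltonian of its restriction to the distribution
    B.leftExtend (B.reducedHamiltonian I.symm) =
      geodesicHamiltonian (B.leftInvariantMetric I) ∧
    B.leftExtend (B.reducedHamiltonianStar I.symm D) =
      subRiemannianHamiltonian (B.leftInvariantMetric I) (leftInvariantDistribution D) ∧
    -- the three problems have the same flow on the constraint submanifold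
    ∃ Φ : ℝ → constraintSubmanifold (B.leftInvariantMetric I) (leftInvariantDistribution D) →
        constraintSubmanifold (B.leftInvariantMetric I) (leftInvariantDistribution D),
      IsFlowOn (IsNonholonomicTrajectory (B.leftInvariantMetric I) (leftInvariantDistribution D))
        (constraintSubmanifold (B.leftInvariantMetric I) (leftInvariantDistribution D)) Φ ∧
      IsFlowOn (IsHamiltonianTrajectory (B.leftExtend (B.reducedHamiltonian I.symm)))
        (constraintSubmanifold (B.leftInvariantMetric I) (leftInvariantDistribution D)) Φ ∧
      IsFlowOn (IsHamiltonianTrajectory (B.leftExtend (B.reducedHamiltonianStar I.symm D)))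
        (constraintSubmanifold (B.leftInvariantMetric I) (leftInvariantDistribution D)) Φ := by
  let T : E ≃L[ℝ] E := I
  let A : E →L[ℝ] E := T.symm
  have hsymm : ∀ v w : E, B.formCLM v (T.symm w) = B.formCLM (T.symm v) w := fun v w =>
    (congrArg (fun u => B.formCLM u (T.symm w)) (T.apply_symm_apply v).symm).trans
      ((hI_symm (T.symm v) (T.symm w)).trans
        (congrArg (B.formCLM (T.symm v)) (T.apply_symm_apply w)))
  have hbr := bracket_mem_of_invariant (E := E) (E' := E') B D A hsymm hι.contMDiff
    (fun η hη => by
      rw [← hL] at hη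
      obtain ⟨y, hy⟩ := hη
      exact ⟨y, hy⟩)
    (fun k ξ hξ => by
      have h : (1 / 2 : ℝ) * B.formCLM (adDeriv (ι k) ξ) (A (adDeriv (ι k) ξ)) =
          (1 / 2 : ℝ) * B.formCLM ξ (A ξ) := hInv k ξ hξ
      exact mul_left_cancel₀ (one_half_pos (α := ℝ)).ne' h)
  have hM := B.constraintSubmanifold_eq T D hA_D
  exact ⟨hM, B.leftExtend_eq_geodesicHamiltonian T,
    B.leftExtend_eq_subRiemannianHamiltonian T D hI_symm hI_pos hA_D,
    B.exists_common_flow D T hsymm hA_D hA_L hbr _ hM⟩
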